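/- **Setting.** Let $p,q,n$ be natural numbers, $\beta>0$, $M>1$, $\delta\in\mathbb R$ and $\sigma:[0,2\pi]\to\mathbb R$. A linear dynamical system (LDS) on the nodes $V=\{1,\dots,p\}$ is $$x_i(k)=\sum_{j}(h_{ij}\star x_j)(k)+e_i(k),\qquad k\in\mathbb Z,\ 1\le i\le p,$$ with real $\ell^1$ impulse responses $h_{ij}$, such that the directed graph $G$ with an edge $j\to i$ iff $h_{ij}\neq0$ is acyclic ($G$ is the DDAG of the system), and where $e_1,\dots,e_p$ are zero-mean stationary Gaussian processes, uncorrelated across nodes, with a common absolutely summable autocovariance $r$. Write $\mathbf H(\omega)=\sum_k h(k)e^{-i\omega k}$ for the transfer matrix, $\Phi_{\mathbf e}(\omega)=\big(\sum_k r(k)e^{-i\omega k}\big)I$ and $\Phi_{\mathbf x}(\omega)=(I-\mathbf H(\omega))^{-1}\Phi_{\mathbf e}(\omega)\big((I-\mathbf H(\omega))^{-1}\big)^*$ for the power spectral density matrices of $e$ and $x$. Let $\mathcal H_{p,q}(\beta,\sigma,M)$ be the family of all such systems $H$ whose DDAG $G(H)$ has at most $q$ parents per node and for which, for all $\omega\in[0,2\pi]$: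 $|\mathbf H_{ij}(\omega)|\ge\beta$ for every edge $j\to i$, $\Phi_{\mathbf e}(\omega)=\sigma(\omega)I$, and $M^{-1}\le\lambda_{\min}(\Phi_{\mathbf x}(\omega))\le\lambda_{\max}(\Phi_{\mathbf x}(\omega))\le M$. **Samples.** Fix a frequency $\omega\in[0,2\pi]$. The data are $n$ samples $\mathbf x^1(\omega),\dots,\mathbf x^n(\omega)\in\mathbb C^p$ of one of the following kinds: (i) i.i.d. circularly symmetric complex Gaussian vectors $N(0,\Phi_{\mathbf x}(\omega))$; (ii) for some $N$, $\mathbf x^r(\omega)=N^{-1/2}\sum_{k=0}^{N-1}x^r(k)e^{-i\omega k}$ for $n$ independent trajectories $x^r$ of length $N$ of the stationary process $x$ (restart and record); (iii) the same with $x^1,\dots,x^n$ the $n$ consecutive segments of length $N$ of a single trajectory of length $nN$ (continuous sampling). **Theorem.** Suppose that $1\le q\le p/2$, that the parameter $q$ is attained in the family (some system in $\mathcal H_{p,q}(\beta,\sigma,M)$ has a node with exactly $q$ parents), and that $$n\le(1-2\delta)\max\left(\frac{\log p}{2\beta^2+\beta^4},\ \frac{q\log(p/q)}{M^2-1}\right).$$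 Then for each of the sampling schemes (i)–(iii), every measurable estimator $\widehat G$ of the DDAG from the samples $\mathbf x^1(\omega),\dots,\mathbf x^n(\omega)$ satisfies $$\max_{H\in\mathcal H_{p,q}(\beta,\sigma,M)}\mathbb P\{G(H)\neq\widehat G\}\ \ge\ \delta ,$$ in the sense that some $H\in\mathcal H_{p,q}(\beta,\sigma,M)$ has $\mathbb P\{G(H)\neq\widehat G\}\ge\delta$; in particular $\inf_{\widehat G}\sup_{H}\mathbb P\{G(H)\neq\widehat G\}\ge\delta$. -/

import Mathlib

open MeasureTheory ProbabilityTheory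

noncomputable section

namespace DDAG

/-- Discrete-time Fourier transform `∑ₖ a(k) e^{-iωk}` of a real two-sided sequence. -/
def dtft (a : ℤ → ℝ) (ω : ℝ) : ℂ :=
  ∑' k : ℤ, (a k : ℂ) * Complex.exp (-(Complex.I * ω * k))

/-- A digraph is acyclic if there is no directed path (of length at least one) from a node
to itself. -/
def IsAcyclic {V : Type*} (G : Digraph V) : Prop :=
  ∀ i, ¬ Relation.TransGen G.Adj i i

/-- `pa(i)`: the set of parents of the node `i`. -/
def parents {V : Type*} (G : Digraph V) (i : V) : Set V :=
  {j | G.Adj j i}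

/-- The DAGs on `p` nodes with at most `q` parents per node. -/
def dagFamily (p q : ℕ) : Set (Digraph (Fin p)) :=
  {G | IsAcyclic G ∧ ∀ i, (parents G i).ncard ≤ q}

/-- The directed graph of a matrix of impulse responses: `j → i` is an edge iff `h i j ≠ 0`. -/
def filterGraph {p : ℕ} (h : Fin p → Fin p → ℤ → ℝ) : Digraph (Fin p) where
  Adj j i := h i j ≠ 0

/-- A linear dynamical system over a DAG,
`x_i(k) = ∑_j (h_{ij} ⋆ x_j)(k) + e_i(k)`, `k ∈ ℤ`,
with `ℓ¹` impulse responses `h i j`. The noises `e_i` are zero-mean stationary Gaussian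
processes, uncorrelated across nodes, with common autocovariance
`r k = E[e_i(k) e_i(0)]`, a symmetric, positive semidefinite, summable sequence. -/
structure LDS (p : ℕ) where
  h : Fin p → Fin p → ℤ → ℝ
  h_summable : ∀ i j, Summable (h i j)
  acyclic : IsAcyclic (filterGraph h)
  r : ℤ → ℝ
  r_summable : Summable r
  r_symm : ∀ k, r (-k) = r k
  r_posSemidef : ∀ (s : Finset ℤ) (c : ℤ → ℝ),
    0 ≤ ∑ a ∈ s, ∑ b ∈ s, c a * c b * r (a - b)

namespace LDS

variable {p : ℕ} (S : LDS p)

/-- The DDAG `G(H)` of the system. -/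
def graph : Digraph (Fin p) := filterGraph S.h

/-- The transfer matrix `H(ω)`. -/
def transfer (ω : ℝ) : Matrix (Fin p) (Fin p) ℂ :=
  Matrix.of fun i j => dtft (S.h i j) ω

/-- The power spectral density of each noise, so that `Φ_e(ω) = noisePsd ω • I`. -/
def noisePsd (ω : ℝ) : ℂ := dtft S.r ω

/-- The power spectral density matrix of the states,
`Φ_x(ω) = (I - H(ω))⁻¹ Φ_e(ω) ((I - H(ω))⁻¹)^*`. -/
def psdm (ω : ℝ) : Matrix (Fin p) (Fin p) ℂ :=
  (1 - S.transfer ω)⁻¹ * (S.noisePsd ω • (1 : Matrix (Fin p) (Fin p) ℂ)) *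
    ((1 - S.transfer ω)⁻¹).conjTranspose

lemma star_noisePsd (ω : ℝ) : star (S.noisePsd ω) = S.noisePsd ω := by
  unfold noisePsd dtft
  rw [tsum_star, ← (Equiv.neg ℤ).tsum_eq]
  refine tsum_congr fun k => ?_
  simp only [Equiv.neg_apply, S.r_symm, RCLike.star_def, map_mul, ← Complex.exp_conj,
    Complex.conj_ofReal, map_neg, Complex.conj_I]
  simp

lemma psdm_isHermitian (ω : ℝ) : (S.psdm ω).IsHermitian := by
  unfold psdm Matrix.IsHermitian
  rw [Matrix.conjTranspose_mul, Matrix.conjTranspose_mul, Matrix.conjTranspose_conjTranspose,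
    Matrix.conjTranspose_smul, Matrix.conjTranspose_one, star_noisePsd, Matrix.mul_assoc]

/-- The autocorrelation `R_x(k) = E[x(k) x(0)ᵀ]` of the states: the inverse DTFT of `Φ_x`
(which is real since the impulse responses and `r` are real). -/
def autocorr (k : ℤ) : Matrix (Fin p) (Fin p) ℝ :=
  Matrix.of fun i j =>
    ((1 / (2 * Real.pi) : ℂ) *
      ∫ ω in (0 : ℝ)..(2 * Real.pi), S.psdm ω i j * Complex.exp (Complex.I * ω * k)).re

/-- The law of `L` consecutive states `x(0), …, x(L-1)`: centered Gaussian with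
`E[x_i(s) x_j(t)] = R_x(s - t)_{ij}`. -/
def windowLaw (L : ℕ) : Measure (Fin L → Fin p → ℝ) :=
  (multivariateGaussian (0 : EuclideanSpace ℝ (Fin L × Fin p))
    (Matrix.of fun a b : Fin L × Fin p => S.autocorr ((a.1 : ℤ) - (b.1 : ℤ)) a.2 b.2)).map
    fun x t i => x (t, i)

end LDS

/-- The family `H_{p,q}(β,σ,M)`. -/
def family (p q : ℕ) (β : ℝ) (σ : ℝ → ℝ) (M : ℝ) : Set (LDS p) :=
  {S | S.graph ∈ dagFamily p q ∧
    ∀ ω ∈ Set.Icc 0 (2 * Real.pi),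
      (∀ i j, S.graph.Adj j i → β ≤ ‖S.transfer ω i j‖) ∧
      S.noisePsd ω = (σ ω : ℂ) ∧
      ∀ i, M⁻¹ ≤ (S.psdm_isHermitian ω).eigenvalues i ∧
        (S.psdm_isHermitian ω).eigenvalues i ≤ M}

/-- The normalized finite Fourier transform `N^{-1/2} ∑_{k<N} y(k) e^{-iωk}` of a segment of
`N` states. -/
def segmentDFT {p N : ℕ} (ω : ℝ) (y : Fin N → Fin p → ℝ) : Fin p → ℂ := fun i =>
  (1 / Real.sqrt N : ℂ) * ∑ k : Fin N, (y k i : ℂ) * Complex.exp (-(Complex.I * ω * (k : ℕ)))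

/-- The circularly symmetric complex Gaussian distribution with mean `0` and variance `v`. -/
def complexGaussian (v : NNReal) : Measure ℂ :=
  ((gaussianReal 0 (v / 2)).prod (gaussianReal 0 (v / 2))).map
    fun z => (z.1 : ℂ) + (z.2 : ℂ) * Complex.I

/-- How the `n` samples at a given frequency are obtained. -/
inductive Sampling where
  /-- Independent draws of `x(ω) ∼ N(0, Φ_x(ω))`. -/
  | spectral : Sampling
  /-- Finite Fourier transforms of `n` independent trajectories of length `N`. -/
  | restartRecord (N : ℕ) : Sampling
  /-- Finite Fourier transforms of the `n` consecutive segments of length `N` of one trajectory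
  of length `n * N`. -/
  | continuous (N : ℕ) : Sampling

/-- The law of the complex Gaussian vector `x(ω)` that solves `x(ω) = H(ω) x(ω) + e(ω)` with
`e(ω) ∼ N(0, Φ_e(ω))`. -/
def LDS.spectralLaw {p : ℕ} (S : LDS p) (ω : ℝ) : Measure (Fin p → ℂ) :=
  (Measure.pi fun _ : Fin p => complexGaussian (S.noisePsd ω).re.toNNReal).map
    fun e => ((1 - S.transfer ω)⁻¹).mulVec e

/-- The joint law of the samples `x¹(ω), …, xⁿ(ω)`. -/
def LDS.sampleLaw {p : ℕ} (S : LDS p) (n : ℕ) (ω : ℝ) : Sampling → Measure (Fin n → Fin p → ℂ)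
  | .spectral => Measure.pi fun _ : Fin n => S.spectralLaw ω
  | .restartRecord N =>
      (Measure.pi fun _ : Fin n => S.windowLaw N).map fun y a => segmentDFT ω (y a)
  | .continuous N =>
      (S.windowLaw (n * N)).map fun y a =>
        segmentDFT ω fun k : Fin N => y (finProdFinEquiv (a, k))

/-- A (measurable) estimator of the DDAG from `n` samples. -/
def IsEstimator {n p : ℕ} (Ghat : (Fin n → Fin p → ℂ) → Digraph (Fin p)) : Prop :=
  ∀ G, MeasurableSet (Ghat ⁻¹' {G})

end DDAG

end

/-!
Fano's inequality is applied to an ensemble of memoryless systems with the noise of a given member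
of the family: for each set `T` of `m` nodes, a bipartite matching of `T` with nodes outside `T`,
all of whose edges have gain `β`. The reference hypothesis is the system without edges.

Let `H` be the real gain matrix of a matching. Since `H * H = 0`, the states are
`x = (1 + H) e`. Hence, under each sampling scheme, the samples are `1 + H` applied to independent
copies of one and the same Gaussian vector in `ℂ ^ n`, itself a linear image of `2 n` independent
standard normal variables. By data processing, the divergence from the reference law is at most that
between the laws of `((1 + H) ⊗ 1) Z` and `Z`, for a standard normal vector `Z` of dimension
`2 n p`; as `det (1 + H) = 1`, this is at most `n m β ^ 2`. The choices `m = 1` and `m = q` give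
the two terms of the maximum.

That these systems belong to the family is read off from the given member. In an acyclic graph with
an edge, some edge `j → i` has only sources among the parents of `i`, and the corresponding `2 × 2`
block shows that `1 - H(ω)` and its inverse have at least the norm of a shear of gain `β`; a
matching has exactly this norm. A node with `q` parents also gives the row bound
`1 + q β ^ 2 ≤ M σ ≤ M ^ 2`, which compares `β` with `M` in the second term.
-/

open InformationTheory
open scoped ENNReal

noncomputable section

namespace DDAG

section InformationTheory

variable {Ω : Type*} [MeasurableSpace Ω]

/-- The lower bound of the Donsker–Varadhan variational formula. -/
lemma integral_le_toReal_klDiv_add_log_integral_exp {μ ν : Measure Ω} [IsProbabilityMeasure μ]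
    [IsProbabilityMeasure ν] (hμν : klDiv μ ν ≠ ∞) {f : Ω → ℝ} (hf : Integrable f μ)
    (hexp : Integrable (fun ω => Real.exp (f ω)) ν) :
    ∫ ω, f ω ∂μ ≤ (klDiv μ ν).toReal + Real.log (∫ ω, Real.exp (f ω) ∂ν) := by
  obtain ⟨hac, hllr⟩ := klDiv_ne_top_iff.1 hμν
  have := isProbabilityMeasure_tilted hexp
  have hnonneg := integral_llr_add_sub_measure_univ_nonneg
    (hac.trans (absolutelyContinuous_tilted hexp)) (integrable_llr_tilted_right hac hf hllr hexp)
  rw [integral_llr_tilted_right hac hf hexp hllr] at hnonneg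
  have hkl := toReal_klDiv_of_measure_eq hac (by simp)
  simp only [probReal_univ] at hnonneg
  linarith

lemma mul_measureReal_le_add_log {μ ν : Measure Ω} [IsProbabilityMeasure μ]
    [IsProbabilityMeasure ν] {D : ℝ} (hD : 0 ≤ D) (hμν : klDiv μ ν ≤ ENNReal.ofReal D)
    {E : Set Ω} (hE : MeasurableSet E) (t : ℝ) :
    t * μ.real E ≤ D + Real.log (1 + (Real.exp t - 1) * ν.real E) := by
  have hexp : (fun ω => Real.exp (E.indicator (fun _ => t) ω)) =
      fun ω => 1 + E.indicator (fun _ => Real.exp t - 1) ω := by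
    ext ω
    by_cases hω : ω ∈ E <;> simp [hω]
  have hint (ρ : Measure Ω) [IsProbabilityMeasure ρ] (c : ℝ) :
      Integrable (E.indicator fun _ => c) ρ := (integrable_const c).indicator hE
  have hDV := integral_le_toReal_klDiv_add_log_integral_exp
    (hμν.trans_lt ENNReal.ofReal_lt_top).ne (hint μ t)
    (by rw [hexp]; exact (integrable_const 1).add (hint ν _))
  rw [hexp, integral_add (integrable_const 1) (hint ν _), integral_indicator_const _ hE,
    integral_indicator_const _ hE] at hDV
  have hkl : (klDiv μ ν).toReal ≤ D := ENNReal.toReal_le_of_le_ofReal hD hμν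
  simp only [smul_eq_mul, integral_const, probReal_univ, mul_one] at hDV
  rw [mul_comm t, mul_comm (Real.exp t - 1)]
  linarith

lemma exists_measureReal_preimage_singleton_le {α Θ : Type*} {s : Finset α} (hs : s.Nonempty)
    {θ₀ : Θ} {θ : α → Θ} (hθ : Set.InjOn θ s) (hθ₀ : ∀ x ∈ s, θ x ≠ θ₀) (Q : Measure Ω)
    [IsFiniteMeasure Q] {est : Ω → Θ} (hest : ∀ x, MeasurableSet (est ⁻¹' {x})) :
    ∃ x ∈ s, Q.real (est ⁻¹' {θ x}) ≤ Q.real {ω | θ₀ ≠ est ω} / s.card := by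
  have hdisj : (s : Set α).PairwiseDisjoint fun x => est ⁻¹' {θ x} := fun x hx y hy hxy =>
    Set.disjoint_iff_forall_ne.2 fun a ha b hb hab =>
      hxy (hθ hx hy (ha.symm.trans ((congrArg est hab).trans hb)))
  refine Finset.exists_le_of_sum_le hs ?_
  rw [← measureReal_biUnion_finset hdisj fun x _ => hest _, Finset.sum_const, nsmul_eq_mul,
    mul_div_cancel₀ _ (Nat.cast_ne_zero.2 hs.card_pos.ne')]
  refine measureReal_mono fun ω hω => ?_
  obtain ⟨x, hx, hω⟩ := Set.mem_iUnion₂.1 hω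
  exact fun h => hθ₀ x hx (hω.symm.trans h.symm)

/-- A form of Fano's inequality: the divergences are measured from the law `Q` of an additional
hypothesis `θ₀`, and an error under `θ₀` counts as well. -/
lemma exists_error_ge_of_klDiv_le {α Θ : Type*} {s : Finset α} (hs : 2 ≤ s.card) {θ₀ : Θ}
    {θ : α → Θ} (hθ : Set.InjOn θ s) (hθ₀ : ∀ x ∈ s, θ x ≠ θ₀) {Q : Measure Ω}
    [IsProbabilityMeasure Q] {P : α → Measure Ω} [∀ x, IsProbabilityMeasure (P x)] {D δ : ℝ}
    (hD : 0 ≤ D) (hPQ : ∀ x ∈ s, klDiv (P x) Q ≤ ENNReal.ofReal D)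
    (hδ : D ≤ (1 - 2 * δ) * Real.log s.card) {est : Ω → Θ}
    (hest : ∀ x, MeasurableSet (est ⁻¹' {x})) :
    δ ≤ Q.real {ω | θ₀ ≠ est ω} ∨ ∃ x ∈ s, δ ≤ (P x).real {ω | θ x ≠ est ω} := by
  by_contra! ⟨hQ, hP⟩
  obtain ⟨x, hx, hQx⟩ :=
    exists_measureReal_preimage_singleton_le (Finset.card_pos.1 (by omega)) hθ hθ₀ Q hest
  have hδ0 : 0 < δ := measureReal_nonneg.trans_lt hQ
  have hcard : (1 : ℝ) < s.card := by exact_mod_cast hs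
  have hPx : 1 - δ < (P x).real (est ⁻¹' {θ x}) := by
    have hcompl : {ω | θ x ≠ est ω} = (est ⁻¹' {θ x})ᶜ := by ext; simp [eq_comm]
    have := hP x hx
    rw [hcompl, probReal_compl_eq_one_sub (hest _)] at this
    linarith
  have hDV := mul_measureReal_le_add_log hD (hPQ x hx) (hest (θ x)) (Real.log s.card)
  rw [Real.exp_log (by linarith)] at hDV
  have hlog : Real.log (1 + (s.card - 1) * Q.real (est ⁻¹' {θ x})) ≤ δ * Real.log s.card :=
    calc Real.log (1 + (s.card - 1) * Q.real (est ⁻¹' {θ x}))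
        ≤ (s.card - 1) * Q.real (est ⁻¹' {θ x}) := by
          have := Real.log_le_sub_one_of_pos (x := 1 + (s.card - 1) * Q.real (est ⁻¹' {θ x}))
            (by nlinarith [measureReal_nonneg (μ := Q) (s := est ⁻¹' {θ x})])
          linarith
      _ ≤ (s.card - 1) * (δ / s.card) := by
          refine mul_le_mul_of_nonneg_left (hQx.trans ?_) (by linarith)
          gcongr
      _ = δ * (1 - (s.card : ℝ)⁻¹) := by field_simp
      _ ≤ δ * Real.log s.card := by
          gcongr
          exact Real.one_sub_inv_le_log_of_pos (by linarith)
  nlinarith [Real.log_pos hcard]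

end InformationTheory

/-- The standard normal distribution on `ι → ℝ`. -/
abbrev stdNormal (ι : Type*) [Fintype ι] : Measure (ι → ℝ) :=
  Measure.pi fun _ => gaussianReal 0 1

/-- The law of `∑ k, z k • v k` for independent standard normal variables `z k`: a centred Gaussian
law presented by a factor `v` of its covariance. -/
def gaussianSum {κ E : Type*} [Fintype κ] [AddCommGroup E] [Module ℝ E] [MeasurableSpace E]
    (v : κ → E) : Measure E :=
  (stdNormal κ).map fun z => ∑ k, z k • v k

section GaussianSum

variable {κ κ' E : Type*} [Fintype κ] [Fintype κ'] [NormedAddCommGroup E] [NormedSpace ℝ E]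
  [MeasurableSpace E] [BorelSpace E] [SecondCountableTopology E]

lemma measurable_sum_smul (v : κ → E) : Measurable fun z : κ → ℝ => ∑ k, z k • v k := by
  fun_prop

instance (v : κ → E) : IsProbabilityMeasure (gaussianSum v) :=
  Measure.isProbabilityMeasure_map (measurable_sum_smul v).aemeasurable

lemma charFunDual_gaussianSum (v : κ → E) (L : StrongDual ℝ E) :
    charFunDual (gaussianSum v) L = Complex.exp (-((∑ k, L (v k) ^ 2 : ℝ) : ℂ) / 2) := by
  rw [charFunDual_apply, gaussianSum, integral_map (measurable_sum_smul v).aemeasurable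
    (Measurable.aestronglyMeasurable (by fun_prop))]
  simp_rw [map_sum, map_smul, Complex.ofReal_sum, Finset.sum_mul, Complex.exp_sum]
  rw [integral_fintype_prod_eq_prod (f := fun k x => Complex.exp ((x • L (v k) : ℝ) * Complex.I))]
  simp_rw [smul_eq_mul, mul_comm _ (L (v _)), Complex.ofReal_mul, ← charFun_apply_real,
    charFun_gaussianReal]
  rw [← Complex.exp_sum]
  congr 1
  simp [Finset.sum_div, neg_div]

lemma gaussianSum_congr [CompleteSpace E] {v : κ → E} {w : κ' → E}
    (h : ∀ L : StrongDual ℝ E, ∑ k, L (v k) ^ 2 = ∑ k, L (w k) ^ 2) :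
    gaussianSum v = gaussianSum w := by
  refine Measure.ext_of_charFunDual (funext fun L => ?_)
  rw [charFunDual_gaussianSum, charFunDual_gaussianSum, h]

lemma gaussianSum_comp_equiv [CompleteSpace E] (e : κ' ≃ κ) (v : κ → E) :
    gaussianSum (v ∘ e) = gaussianSum v :=
  gaussianSum_congr fun L => e.sum_comp fun k => L (v k) ^ 2

lemma map_gaussianSum {F : Type*} [NormedAddCommGroup F] [NormedSpace ℝ F] [MeasurableSpace F]
    [BorelSpace F] (v : κ → E) (Φ : E →L[ℝ] F) :
    (gaussianSum v).map Φ = gaussianSum (Φ ∘ v) := by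
  rw [gaussianSum, gaussianSum, Measure.map_map (by fun_prop) (by fun_prop)]
  congr 1
  ext z
  simp

lemma pi_gaussianSum {ι : Type*} [Fintype ι] [DecidableEq ι] [CompleteSpace E] (v : κ → E) :
    Measure.pi (fun _ : ι => gaussianSum v) =
      gaussianSum fun a : ι × κ => (Pi.single a.1 (v a.2) : ι → E) := by
  refine Measure.ext_of_charFunDual (funext fun L => ?_)
  rw [charFunDual_pi, charFunDual_gaussianSum]
  simp_rw [charFunDual_gaussianSum]
  rw [← Complex.exp_sum, Fintype.sum_prod_type]
  simp [Finset.sum_div, neg_div]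

lemma gaussianSum_eq_gaussianReal (v : κ → ℝ) :
    gaussianSum v = gaussianReal 0 (∑ k, v k ^ 2).toNNReal := by
  have hv : 0 ≤ ∑ k, v k ^ 2 := Finset.sum_nonneg fun k _ => sq_nonneg _
  refine Measure.ext_of_charFun (funext fun x => ?_)
  rw [charFun_gaussianReal, charFun_eq_charFunDual_toDualMap, charFunDual_gaussianSum]
  congr 1
  simp [mul_pow, ← Finset.sum_mul, Real.coe_toNNReal _ hv, neg_div]

lemma gaussianReal_eq_gaussianSum (v : NNReal) :
    gaussianReal 0 v = gaussianSum fun _ : Unit => √v := by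
  simp [gaussianSum_eq_gaussianReal, Real.sq_sqrt]

lemma multivariateGaussian_eq_gaussianSum {ι κ : Type*} [Fintype ι] [DecidableEq ι] [Fintype κ]
    (B : Matrix ι κ ℝ) :
    multivariateGaussian (0 : EuclideanSpace ℝ ι) (B * B.transpose) =
      gaussianSum fun k => (WithLp.toLp 2 fun i => B i k : EuclideanSpace ℝ ι) := by
  have hS : (B * B.transpose).PosSemidef := by
    simpa using Matrix.posSemidef_self_mul_conjTranspose B
  refine Measure.ext_of_charFun (funext fun x => ?_)
  rw [charFun_multivariateGaussian hS, charFun_eq_charFunDual_toDualMap,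
    charFunDual_gaussianSum]
  congr 1
  rw [← Matrix.mulVec_mulVec, Matrix.dotProduct_mulVec, ← Matrix.mulVec_transpose]
  simp [dotProduct, Matrix.mulVec, sq, PiLp.inner_apply, neg_div]

lemma integrable_sq_gaussianReal (v : NNReal) :
    Integrable (fun x : ℝ => x ^ 2) (gaussianReal 0 v) :=
  (memLp_id_gaussianReal 2).integrable_sq

lemma integral_sq_gaussianReal (v : NNReal) : ∫ x : ℝ, x ^ 2 ∂gaussianReal 0 v = v := by
  have hvar := variance_id_gaussianReal (μ := 0) (v := v)
  rwa [variance_of_integral_eq_zero (by fun_prop) (by simp)] at hvar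

lemma integrable_sq_dotProduct_stdNormal (v : κ → ℝ) :
    Integrable (fun z : κ → ℝ => (v ⬝ᵥ z) ^ 2) (stdNormal κ) := by
  have h : Integrable (fun x : ℝ => x ^ 2) (gaussianSum v) := by
    rw [gaussianSum_eq_gaussianReal]
    exact integrable_sq_gaussianReal _
  convert h.comp_measurable (measurable_sum_smul v) using 3
  simp [dotProduct, mul_comm]

lemma integral_sq_dotProduct_stdNormal (v : κ → ℝ) :
    ∫ z : κ → ℝ, (v ⬝ᵥ z) ^ 2 ∂stdNormal κ = ∑ k, v k ^ 2 := by
  have h := integral_map (measurable_sum_smul v).aemeasurable (μ := stdNormal κ)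
    (f := fun x : ℝ => x ^ 2) (by fun_prop)
  rw [← gaussianSum, gaussianSum_eq_gaussianReal, integral_sq_gaussianReal,
    Real.coe_toNNReal _ (Finset.sum_nonneg fun k _ => sq_nonneg _)] at h
  simpa [dotProduct, mul_comm] using h.symm

end GaussianSum

section LinearImage

variable {ι : Type*} [Fintype ι]

lemma pi_withDensity_ofReal {α : ι → Type*} [∀ i, MeasurableSpace (α i)]
    (μ : ∀ i, Measure (α i)) [∀ i, SigmaFinite (μ i)] {f : ∀ i, α i → ℝ}
    (hf : ∀ i, Integrable (f i) (μ i)) (hf0 : ∀ i x, 0 ≤ f i x) :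
    Measure.pi (fun i => (μ i).withDensity fun x => ENNReal.ofReal (f i x)) =
      (Measure.pi μ).withDensity fun x => ENNReal.ofReal (∏ i, f i (x i)) := by
  refine Measure.pi_eq fun s hs => ?_
  rw [withDensity_apply _ (MeasurableSet.univ_pi hs), Measure.restrict_pi_pi,
    ← ofReal_integral_eq_lintegral_ofReal (Integrable.fintype_prod_dep fun i => (hf i).restrict)
      (ae_of_all _ fun x => Finset.prod_nonneg fun i _ => hf0 i _),
    integral_fintype_prod_eq_prod, ENNReal.ofReal_prod_of_nonneg fun i _ => integral_nonneg (hf0 i)]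
  refine Finset.prod_congr rfl fun i _ => ?_
  rw [withDensity_apply _ (hs i),
    ofReal_integral_eq_lintegral_ofReal (hf i).restrict (ae_of_all _ (hf0 i))]

lemma stdNormal_eq_withDensity :
    stdNormal ι = (volume : Measure (ι → ℝ)).withDensity
      fun x => ENNReal.ofReal ((√(2 * Real.pi))⁻¹ ^ Fintype.card ι * Real.exp (-(x ⬝ᵥ x) / 2)) := by
  have hpdf (x : ι → ℝ) : ∏ i, gaussianPDFReal 0 1 (x i) =
      (√(2 * Real.pi))⁻¹ ^ Fintype.card ι * Real.exp (-(x ⬝ᵥ x) / 2) := by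
    simp only [gaussianPDFReal, NNReal.coe_one, mul_one, sub_zero, sq]
    rw [Finset.prod_mul_distrib, ← Real.exp_sum, ← Finset.sum_div, Finset.sum_neg_distrib,
      Finset.prod_const, Finset.card_univ, dotProduct]
  simp_rw [← hpdf, stdNormal, gaussianReal_of_var_ne_zero 0 one_ne_zero]
  exact pi_withDensity_ofReal _ (fun _ => integrable_gaussianPDFReal 0 1)
    fun _ => gaussianPDFReal_nonneg 0 1

lemma measurable_mulVec (A : Matrix ι ι ℝ) : Measurable A.mulVec :=
  (Continuous.matrix_mulVec continuous_const continuous_id).measurable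

lemma map_mulVec_stdNormal [DecidableEq ι] {A : Matrix ι ι ℝ} (hA : |A.det| = 1) :
    (stdNormal ι).map A.mulVec = (stdNormal ι).withDensity fun x =>
      ENNReal.ofReal (Real.exp ((x ⬝ᵥ x - A⁻¹.mulVec x ⬝ᵥ A⁻¹.mulVec x) / 2)) := by
  have hdet : A.det ≠ 0 := fun h => by simp [h] at hA
  have hvol : (volume : Measure (ι → ℝ)).map A.mulVec = volume := by
    have h := Real.map_matrix_volume_pi_eq_smul_volume_pi hdet
    rwa [abs_inv, hA, inv_one, ENNReal.ofReal_one, one_smul] at h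
  rw [stdNormal_eq_withDensity, ← withDensity_mul _ (by fun_prop) (by fun_prop)]
  ext s hs
  rw [Measure.map_apply (measurable_mulVec A) hs, withDensity_apply _ (measurable_mulVec A hs),
    withDensity_apply _ hs]
  conv_rhs => rw [← hvol]
  rw [setLIntegral_map hs (by fun_prop) (measurable_mulVec A)]
  refine lintegral_congr fun x => ?_
  rw [Pi.mul_apply, ← ENNReal.ofReal_mul (by positivity), mul_assoc, ← Real.exp_add,
    Matrix.mulVec_mulVec, Matrix.nonsing_inv_mul _ hdet.isUnit, Matrix.one_mulVec]
  ring_nf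

lemma map_mulVec_stdNormal_absolutelyContinuous [DecidableEq ι] {A : Matrix ι ι ℝ}
    (hA : |A.det| = 1) : (stdNormal ι).map A.mulVec ≪ stdNormal ι := by
  rw [map_mulVec_stdNormal hA]
  exact withDensity_absolutelyContinuous _ _

lemma llr_map_mulVec_stdNormal [DecidableEq ι] {A : Matrix ι ι ℝ} (hA : |A.det| = 1) :
    (fun z => llr ((stdNormal ι).map A.mulVec) (stdNormal ι) (A.mulVec z)) =ᵐ[stdNormal ι]
      fun z => (A.mulVec z ⬝ᵥ A.mulVec z - z ⬝ᵥ z) / 2 := by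
  have hdet : IsUnit A.det := isUnit_iff_ne_zero.2 fun h => by simp [h] at hA
  have hllr := Measure.rnDeriv_withDensity (stdNormal ι) (f := fun x =>
    ENNReal.ofReal (Real.exp ((x ⬝ᵥ x - A⁻¹.mulVec x ⬝ᵥ A⁻¹.mulVec x) / 2))) (by fun_prop)
  rw [← map_mulVec_stdNormal hA] at hllr
  filter_upwards [ae_of_ae_map (measurable_mulVec A).aemeasurable
    ((map_mulVec_stdNormal_absolutelyContinuous hA).ae_le hllr)] with z hz
  rw [llr, hz, ENNReal.toReal_ofReal (Real.exp_pos _).le, Real.log_exp, Matrix.mulVec_mulVec,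
    Matrix.nonsing_inv_mul _ hdet, Matrix.one_mulVec]

lemma integrable_dotProduct_self_mulVec (A : Matrix ι ι ℝ) :
    Integrable (fun z => A.mulVec z ⬝ᵥ A.mulVec z) (stdNormal ι) :=
  integrable_finsetSum _ fun i _ => by
    simpa only [← sq, Matrix.mulVec] using integrable_sq_dotProduct_stdNormal (A i)

lemma integral_dotProduct_self_mulVec (A : Matrix ι ι ℝ) :
    ∫ z, A.mulVec z ⬝ᵥ A.mulVec z ∂stdNormal ι = ∑ i, ∑ j, A i j ^ 2 := by
  have hint (i : ι) := integrable_sq_dotProduct_stdNormal (A i)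
  simp_rw [← integral_sq_dotProduct_stdNormal, ← integral_finsetSum _ fun i _ => hint i, sq]
  rfl

lemma klDiv_map_mulVec_stdNormal [DecidableEq ι] {A : Matrix ι ι ℝ} (hA : |A.det| = 1) :
    klDiv ((stdNormal ι).map A.mulVec) (stdNormal ι) =
      ENNReal.ofReal ((∑ i, ∑ j, A i j ^ 2 - Fintype.card ι) / 2) := by
  have hid : Integrable (fun z : ι → ℝ => z ⬝ᵥ z) (stdNormal ι) := by
    simpa using integrable_dotProduct_self_mulVec (1 : Matrix ι ι ℝ)
  have hidv : ∫ z : ι → ℝ, z ⬝ᵥ z ∂stdNormal ι = Fintype.card ι := by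
    simpa [Matrix.one_apply] using integral_dotProduct_self_mulVec (1 : Matrix ι ι ℝ)
  have hint := ((integrable_dotProduct_self_mulVec A).sub hid).div_const 2
  have : IsProbabilityMeasure ((stdNormal ι).map A.mulVec) :=
    Measure.isProbabilityMeasure_map (measurable_mulVec A).aemeasurable
  have hllr : AEStronglyMeasurable (llr ((stdNormal ι).map A.mulVec) (stdNormal ι))
      ((stdNormal ι).map A.mulVec) := (measurable_llr _ _).aestronglyMeasurable
  rw [klDiv_of_ac_of_integrable (map_mulVec_stdNormal_absolutelyContinuous hA)
      ((integrable_map_measure hllr (measurable_mulVec A).aemeasurable).2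
      (hint.congr (llr_map_mulVec_stdNormal hA).symm)),
    integral_map (measurable_mulVec A).aemeasurable hllr,
    integral_congr_ae (llr_map_mulVec_stdNormal hA),
    integral_div, integral_sub (integrable_dotProduct_self_mulVec A) hid,
    integral_dotProduct_self_mulVec, hidv]
  simp

lemma klDiv_gaussianSum_le {E : Type*} [NormedAddCommGroup E] [NormedSpace ℝ E]
    [MeasurableSpace E] [BorelSpace E] [SecondCountableTopology E] [DecidableEq ι]
    {A : Matrix ι ι ℝ} (hA : |A.det| = 1) (w : ι → E) :
    klDiv (gaussianSum fun j => ∑ i, A i j • w i) (gaussianSum w) ≤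
      ENNReal.ofReal ((∑ i, ∑ j, A i j ^ 2 - Fintype.card ι) / 2) := by
  have hlaw : gaussianSum (fun j => ∑ i, A i j • w i) =
      ((stdNormal ι).map A.mulVec).map fun z => ∑ i, z i • w i := by
    rw [Measure.map_map (measurable_sum_smul w) (measurable_mulVec A), gaussianSum]
    congr 1
    ext z
    simp only [Function.comp_apply, Matrix.mulVec, dotProduct, Finset.smul_sum, Finset.sum_smul,
      smul_smul, mul_comm (z _)]
    exact Finset.sum_comm
  have := Measure.isProbabilityMeasure_map (μ := stdNormal ι) (measurable_mulVec A).aemeasurable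
  rw [hlaw, gaussianSum, ← klDiv_map_mulVec_stdNormal hA]
  exact klDiv_map_le _ _ (measurable_sum_smul w)

end LinearImage

lemma sum_sq_transpose_mulVec {ι κ : Type*} [Fintype ι] [Fintype κ] (D : Matrix ι κ ℝ)
    (y : ι → ℝ) : ∑ k, (∑ i, D i k * y i) ^ 2 = y ⬝ᵥ (D * D.transpose).mulVec y := by
  rw [← Matrix.mulVec_mulVec, Matrix.dotProduct_mulVec, ← Matrix.mulVec_transpose]
  simp [dotProduct, Matrix.mulVec, sq]

open scoped MatrixOrder in
lemma exists_eq_mul_transpose {ι : Type*} [Fintype ι] {S : Matrix ι ι ℝ}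
    (hS : S.PosSemidef) : ∃ C : Matrix ι ι ℝ, S = C * C.transpose := by
  classical
  obtain ⟨C, hC⟩ := CStarAlgebra.nonneg_iff_eq_star_mul_self.1 hS.nonneg
  exact ⟨C.transpose, by simpa [Matrix.star_eq_conjTranspose] using hC⟩

/-- The law of `A` applied to a vector of independent draws from `μ`. -/
def mixedLaw {ν W : Type*} [Fintype ν] [AddCommGroup W] [Module ℝ W] [MeasurableSpace W]
    (A : Matrix ν ν ℝ) (μ : Measure W) : Measure (ν → W) :=
  (Measure.pi fun _ : ν => μ).map fun w i => ∑ j, A i j • w j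

section MixedLaw

variable {κ ν W : Type*} [Fintype κ] [Fintype ν] [NormedAddCommGroup W] [NormedSpace ℝ W]
  [FiniteDimensional ℝ W] [MeasurableSpace W] [BorelSpace W]

lemma exists_gaussianSum_eq_finrank (v : κ → W) :
    ∃ c : Fin (Module.finrank ℝ W) → W, gaussianSum v = gaussianSum c := by
  let b := Module.finBasis ℝ W
  let D : Matrix (Fin (Module.finrank ℝ W)) κ ℝ := Matrix.of fun i k => b.repr (v k) i
  have hS : (D * D.transpose).PosSemidef := by
    simpa using Matrix.posSemidef_self_mul_conjTranspose D
  obtain ⟨C, hC⟩ := exists_eq_mul_transpose hS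
  refine ⟨fun j => ∑ i, C i j • b i, gaussianSum_congr fun L => ?_⟩
  have hL (k : κ) : L (v k) = ∑ i, D i k * L (b i) := by
    conv_lhs => rw [← b.sum_repr (v k)]
    simp only [map_sum, map_smul, smul_eq_mul, D, Matrix.of_apply]
  simp_rw [hL, map_sum, map_smul, smul_eq_mul]
  rw [sum_sq_transpose_mulVec, sum_sq_transpose_mulVec, hC]

lemma mixedLaw_gaussianSum (A : Matrix ν ν ℝ) (v : κ → W) :
    mixedLaw A (gaussianSum v) = gaussianSum fun x : ν × κ => fun i => A i x.1 • v x.2 := by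
  classical
  let Φ : (ν → W) →L[ℝ] (ν → W) :=
    ContinuousLinearMap.pi fun i => ∑ j, A i j • ContinuousLinearMap.proj j
  have hΦ : ⇑Φ = fun w i => ∑ j, A i j • w j := by ext; simp [Φ]
  rw [mixedLaw, pi_gaussianSum, ← hΦ, map_gaussianSum]
  congr 1
  ext x i
  simp [hΦ, Pi.single_apply]

instance (A : Matrix ν ν ℝ) (v : κ → W) :
    IsProbabilityMeasure (mixedLaw A (gaussianSum v)) := by
  rw [mixedLaw_gaussianSum]
  infer_instance

open scoped Kronecker in
lemma klDiv_mixedLaw_gaussianSum_le [DecidableEq ν] {A : Matrix ν ν ℝ} (hA : |A.det| = 1)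
    (v : κ → W) :
    klDiv (mixedLaw A (gaussianSum v)) (mixedLaw 1 (gaussianSum v)) ≤
      ENNReal.ofReal (Module.finrank ℝ W * (∑ i, ∑ j, A i j ^ 2 - Fintype.card ν) / 2) := by
  obtain ⟨c, hc⟩ := exists_gaussianSum_eq_finrank v
  let B := A ⊗ₖ (1 : Matrix (Fin (Module.finrank ℝ W)) (Fin (Module.finrank ℝ W)) ℝ)
  have hdet : |B.det| = 1 := by simp [B, Matrix.det_kronecker, abs_pow, hA]
  have hfrob : ∑ x, ∑ y, B x y ^ 2 = Module.finrank ℝ W * ∑ i, ∑ j, A i j ^ 2 := by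
    simp [B, Fintype.sum_prod_type, Matrix.one_apply, Finset.mul_sum]
  have hkl := klDiv_gaussianSum_le hdet
    fun x : ν × Fin (Module.finrank ℝ W) => (Pi.single x.1 (c x.2) : ν → W)
  rw [hc, mixedLaw_gaussianSum, mixedLaw_gaussianSum]
  convert hkl using 2
  · congr 1
    ext x i
    simp [B, Fintype.sum_prod_type, Matrix.one_apply, Finset.sum_apply, ite_apply, Pi.single_apply]
  · congr 1
    ext x i
    simp [Matrix.one_apply, Pi.single_apply]
  · rw [hfrob, Fintype.card_prod, Fintype.card_fin]
    push_cast
    ring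

end MixedLaw

lemma prod_gaussianSum {κ κ' E F : Type*} [Fintype κ] [Fintype κ'] [NormedAddCommGroup E]
    [NormedSpace ℝ E] [MeasurableSpace E] [BorelSpace E] [SecondCountableTopology E]
    [CompleteSpace E] [NormedAddCommGroup F] [NormedSpace ℝ F] [MeasurableSpace F] [BorelSpace F]
    [SecondCountableTopology F] [CompleteSpace F] (v : κ → E) (w : κ' → F) :
    (gaussianSum v).prod (gaussianSum w) =
      gaussianSum (Sum.elim (fun k => (v k, 0)) fun k => (0, w k)) := by
  refine Measure.ext_of_charFunDual (funext fun L => ?_)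
  rw [charFunDual_prod]
  simp_rw [charFunDual_gaussianSum]
  rw [← Complex.exp_add]
  simp [add_div]
  ring_nf

lemma complexGaussian_eq_gaussianSum (v : NNReal) :
    complexGaussian v = gaussianSum (Sum.elim (fun _ : Unit => (√(v / 2) : ℂ))
      fun _ : Unit => √(v / 2) * Complex.I) := by
  have hmap : complexGaussian v = ((gaussianReal 0 (v / 2)).prod (gaussianReal 0 (v / 2))).map
      (Complex.equivRealProdCLM.symm : ℝ × ℝ →L[ℝ] ℂ) := by
    unfold complexGaussian
    congr 1
    ext z
    exact (Complex.equivRealProdCLM_symm_apply z).symm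
  rw [hmap, gaussianReal_eq_gaussianSum, prod_gaussianSum, map_gaussianSum]
  congr 1
  ext (k | k) <;> simp [Complex.equivRealProdCLM_symm_apply]

lemma integral_exp_int (k : ℤ) :
    ∫ ω in (0 : ℝ)..(2 * Real.pi), Complex.exp (Complex.I * ω * k) =
      if k = 0 then 2 * Real.pi else 0 := by
  split_ifs with hk
  · simp [hk]
  · have hperiod : Complex.I * k * ((2 * Real.pi : ℝ) : ℂ) = k * (2 * Real.pi * Complex.I) := by
      push_cast
      ring
    have hswap (ω : ℝ) : Complex.I * ω * k = Complex.I * k * ω := mul_right_comm _ _ _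
    simp_rw [hswap]
    rw [integral_exp_mul_complex (by simp [hk]), hperiod, Complex.exp_int_mul_two_pi_mul_I]
    simp

lemma norm_exp_I_mul_mul (x y : ℝ) : ‖Complex.exp (Complex.I * x * y)‖ = 1 := by
  rw [mul_assoc, mul_comm, ← Complex.ofReal_mul, Complex.norm_exp_ofReal_mul_I]

lemma integral_dtft_mul_exp {a : ℤ → ℝ} (ha : Summable a) (k : ℤ) :
    ∫ ω in (0 : ℝ)..(2 * Real.pi), dtft a ω * Complex.exp (Complex.I * ω * k) =
      2 * Real.pi * a k := by
  let f (l : ℤ) : C(ℝ, ℂ) := ⟨fun ω => a l * Complex.exp (Complex.I * ω * (k - l : ℤ)), by fun_prop⟩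
  have hnorm (l : ℤ) (ω : ℝ) : ‖f l ω‖ = |a l| := by
    have h := norm_exp_I_mul_mul ω (k - l : ℤ)
    rw [Complex.ofReal_intCast] at h
    simp only [f, ContinuousMap.coe_mk, norm_mul, h, mul_one, Complex.norm_real, Real.norm_eq_abs]
  have hsummable : Summable fun l =>
      ‖(f l).restrict (⟨Set.uIcc 0 (2 * Real.pi), isCompact_uIcc⟩ : TopologicalSpace.Compacts ℝ)‖ :=
    ha.abs.of_nonneg_of_le (fun l => norm_nonneg _) fun l =>
      (ContinuousMap.norm_le _ (abs_nonneg _)).2 fun x => (hnorm l x).le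
  have hint (l : ℤ) :
      ∫ ω in (0 : ℝ)..(2 * Real.pi), f l ω = if l = k then 2 * Real.pi * (a k : ℂ) else 0 := by
    simp only [f, ContinuousMap.coe_mk]
    rw [intervalIntegral.integral_const_mul, integral_exp_int]
    by_cases h : l = k
    · simp [h, mul_comm]
    · simp [h, sub_eq_zero, Ne.symm h]
  have hsum := (intervalIntegral.hasSum_intervalIntegral_of_summable_norm hsummable).tsum_eq
  simp_rw [hint, tsum_ite_eq] at hsum
  rw [hsum]
  refine intervalIntegral.integral_congr fun ω _ => ?_
  simp only [dtft, f, ContinuousMap.coe_mk, ← tsum_mul_right, mul_assoc, ← Complex.exp_add]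
  congr! 3
  push_cast
  ring_nf

/-- The normalized finite Fourier transform of a real sequence; `segmentDFT` applies it
coordinatewise. -/
def finiteDFT (N : ℕ) (ω : ℝ) : (Fin N → ℝ) →L[ℝ] ℂ :=
  ∑ k : Fin N, (ContinuousLinearMap.proj (R := ℝ) (φ := fun _ => ℝ) k).smulRight
    ((1 / √N : ℂ) * Complex.exp (-(Complex.I * ω * (k : ℕ))))

lemma segmentDFT_apply {p N : ℕ} (ω : ℝ) (y : Fin N → Fin p → ℝ) (i : Fin p) :
    segmentDFT ω y i = finiteDFT N ω fun k => y k i := by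
  simp [segmentDFT, finiteDFT, Finset.mul_sum, mul_left_comm]

lemma segmentDFT_mul {p N : ℕ} (ω : ℝ) (x : Fin N → ℝ) (y : Fin p → ℝ) (i : Fin p) :
    segmentDFT ω (fun k i => x k * y i) i = y i • finiteDFT N ω x := by
  rw [segmentDFT_apply, ← map_smul]
  congr 1
  ext k
  exact mul_comm _ _

lemma segmentDFT_zero {p N : ℕ} (ω : ℝ) : segmentDFT ω (0 : Fin N → Fin p → ℝ) = 0 := by
  ext i
  simp [segmentDFT]

namespace LDS

variable {p : ℕ} {S : LDS p} {A : Matrix (Fin p) (Fin p) ℝ}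

lemma psdm_eq {ω : ℝ} (hA : (1 - S.transfer ω)⁻¹ = A.map Complex.ofReal) :
    S.psdm ω = S.noisePsd ω • (A * A.transpose).map Complex.ofReal := by
  rw [psdm, hA]
  ext i j
  simp [Matrix.mul_apply, Finset.mul_sum, mul_assoc]

lemma autocorr_eq (hA : ∀ ω, (1 - S.transfer ω)⁻¹ = A.map Complex.ofReal) (k : ℤ) :
    S.autocorr k = S.r k • (A * A.transpose) := by
  ext i j
  have hentry (ω : ℝ) : S.psdm ω i j * Complex.exp (Complex.I * ω * k) =
      ((A * A.transpose) i j : ℂ) * (dtft S.r ω * Complex.exp (Complex.I * ω * k)) := by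
    rw [psdm_eq (hA ω)]
    simp only [Matrix.smul_apply, Matrix.map_apply, smul_eq_mul, noisePsd]
    ring
  have hpi : (Real.pi : ℂ) ≠ 0 := by exact_mod_cast Real.pi_ne_zero
  have hreal : (1 / (2 * Real.pi) : ℂ) * (((A * A.transpose) i j : ℂ) * (2 * Real.pi * S.r k)) =
      ((S.r k * (A * A.transpose) i j : ℝ) : ℂ) := by
    push_cast
    field_simp
  simp only [autocorr, Matrix.of_apply, hentry]
  rw [intervalIntegral.integral_const_mul, integral_dtft_mul_exp S.r_summable, hreal,
    Complex.ofReal_re, Matrix.smul_apply, smul_eq_mul]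

lemma posSemidef_toeplitz (S : LDS p) (L : ℕ) :
    (Matrix.of fun s t : Fin L => S.r ((s : ℤ) - (t : ℤ))).PosSemidef := by
  refine Matrix.PosSemidef.of_dotProduct_mulVec_nonneg ?_ fun x => ?_
  · ext s t
    simp only [Matrix.conjTranspose_apply, Matrix.of_apply, star_trivial]
    rw [← S.r_symm, neg_sub]
  · let e : Fin L ↪ ℤ := ⟨fun s => (s : ℤ), fun s t h => by simpa [Fin.ext_iff] using h⟩
    have h := S.r_posSemidef (Finset.univ.map e) (Function.extend e x 0)
    simp only [Finset.sum_map, e.injective.extend_apply] at h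
    refine h.trans_eq ?_
    simp only [dotProduct, Matrix.mulVec, star_trivial, Finset.mul_sum, Matrix.of_apply]
    refine Finset.sum_congr rfl fun s _ => Finset.sum_congr rfl fun t _ => ?_
    change x s * x t * S.r ((s : ℤ) - (t : ℤ)) = _
    ring

lemma windowLaw_eq_gaussianSum {L : ℕ} {B : Matrix (Fin L) (Fin L) ℝ}
    (hB : (Matrix.of fun s t : Fin L => S.r ((s : ℤ) - (t : ℤ))) = B * B.transpose)
    (hA : ∀ ω, (1 - S.transfer ω)⁻¹ = A.map Complex.ofReal) :
    S.windowLaw L = gaussianSum fun x : Fin L × Fin p => fun t i => B t x.1 * A i x.2 := by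
  let C : Matrix (Fin L × Fin p) (Fin L × Fin p) ℝ := Matrix.of fun a b => B a.1 b.1 * A a.2 b.2
  have hC : (Matrix.of fun a b : Fin L × Fin p => S.autocorr ((a.1 : ℤ) - (b.1 : ℤ)) a.2 b.2) =
      C * C.transpose := by
    ext a b
    have h := congrFun (congrFun hB a.1) b.1
    simp only [Matrix.of_apply] at h
    simp only [Matrix.of_apply, autocorr_eq hA, Matrix.smul_apply, h, smul_eq_mul,
      Matrix.mul_apply, C, Matrix.transpose_apply, Fintype.sum_prod_type, Finset.sum_mul_sum]
    exact Finset.sum_congr rfl fun s _ => Finset.sum_congr rfl fun t _ => by ring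
  let Φ : EuclideanSpace ℝ (Fin L × Fin p) →L[ℝ] (Fin L → Fin p → ℝ) :=
    ContinuousLinearMap.pi fun t => ContinuousLinearMap.pi fun i => EuclideanSpace.proj (t, i)
  rw [windowLaw, hC, multivariateGaussian_eq_gaussianSum]
  exact map_gaussianSum _ Φ

section SampleLaw

variable (n : ℕ) {ω : ℝ}

lemma sampleLaw_spectral {κ : Type*} [Fintype κ] {c : κ → ℂ}
    (hc : complexGaussian (S.noisePsd ω).re.toNNReal = gaussianSum c)
    (hA : (1 - S.transfer ω)⁻¹ = A.map Complex.ofReal) :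
    S.sampleLaw n ω .spectral = gaussianSum fun x : Fin p × (Fin n × κ) => fun a i =>
      A i x.1 • (Pi.single x.2.1 (c x.2.2) : Fin n → ℂ) a := by
  let Φ : (Fin p → ℂ) →L[ℝ] (Fin p → ℂ) :=
    ((A.map Complex.ofReal).mulVecLin.restrictScalars ℝ).toContinuousLinearMap
  have hΦ : ⇑Φ = (A.map Complex.ofReal).mulVec := rfl
  let e : Fin p × (Fin n × κ) ≃ Fin n × (Fin p × κ) :=
    ⟨fun x => (x.2.1, x.1, x.2.2), fun x => (x.2.1, x.1, x.2.2), fun _ => rfl, fun _ => rfl⟩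
  simp only [sampleLaw, spectralLaw, hc, hA]
  rw [pi_gaussianSum, ← hΦ, map_gaussianSum, pi_gaussianSum, ← gaussianSum_comp_equiv e]
  congr 1
  ext x a i
  obtain rfl | h := eq_or_ne a x.2.1
  · simp [e, hΦ, Matrix.mulVec_single, mul_comm]
  · simp [e, h]

lemma sampleLaw_restartRecord {N : ℕ} {B : Matrix (Fin N) (Fin N) ℝ}
    (hB : (Matrix.of fun s t : Fin N => S.r ((s : ℤ) - (t : ℤ))) = B * B.transpose)
    (hA : ∀ ω, (1 - S.transfer ω)⁻¹ = A.map Complex.ofReal) :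
    S.sampleLaw n ω (.restartRecord N) = gaussianSum fun x : Fin p × (Fin n × Fin N) => fun a i =>
      A i x.1 • (Pi.single x.2.1 (finiteDFT N ω fun t => B t x.2.2) : Fin n → ℂ) a := by
  let Φ : (Fin n → Fin N → Fin p → ℝ) →L[ℝ] (Fin n → Fin p → ℂ) :=
    ContinuousLinearMap.pi fun a => ContinuousLinearMap.pi fun i =>
      (finiteDFT N ω).comp (ContinuousLinearMap.pi fun k =>
        ContinuousLinearMap.proj i ∘L ContinuousLinearMap.proj k ∘L ContinuousLinearMap.proj a)
  have hΦ : ⇑Φ = fun y a => segmentDFT ω (y a) := by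
    ext y a i
    exact (segmentDFT_apply ω (y a) i).symm
  let e : Fin p × (Fin n × Fin N) ≃ Fin n × (Fin N × Fin p) :=
    ⟨fun x => (x.2.1, x.2.2, x.1), fun x => (x.2.2, x.1, x.2.1), fun _ => rfl, fun _ => rfl⟩
  simp only [sampleLaw, windowLaw_eq_gaussianSum hB hA]
  rw [pi_gaussianSum, ← hΦ, map_gaussianSum, ← gaussianSum_comp_equiv e]
  congr 1
  ext x a i
  obtain rfl | h := eq_or_ne a x.2.1
  · simp [e, hΦ, segmentDFT_mul]
  · simp [e, hΦ, h, segmentDFT_zero]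

lemma sampleLaw_continuous {N : ℕ} {B : Matrix (Fin (n * N)) (Fin (n * N)) ℝ}
    (hB : (Matrix.of fun s t : Fin (n * N) => S.r ((s : ℤ) - (t : ℤ))) = B * B.transpose)
    (hA : ∀ ω, (1 - S.transfer ω)⁻¹ = A.map Complex.ofReal) :
    S.sampleLaw n ω (.continuous N) = gaussianSum fun x : Fin p × Fin (n * N) => fun a i =>
      A i x.1 • finiteDFT N ω fun t => B (finProdFinEquiv (a, t)) x.2 := by
  let Φ : (Fin (n * N) → Fin p → ℝ) →L[ℝ] (Fin n → Fin p → ℂ) :=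
    ContinuousLinearMap.pi fun a => ContinuousLinearMap.pi fun i =>
      (finiteDFT N ω).comp (ContinuousLinearMap.pi fun k =>
        ContinuousLinearMap.proj i ∘L ContinuousLinearMap.proj (finProdFinEquiv (a, k)))
  have hΦ : ⇑Φ = fun y a => segmentDFT ω fun k : Fin N => y (finProdFinEquiv (a, k)) := by
    ext y a i
    exact (segmentDFT_apply ω _ i).symm
  simp only [sampleLaw, windowLaw_eq_gaussianSum hB hA]
  rw [← hΦ, map_gaussianSum, ← gaussianSum_comp_equiv (Equiv.prodComm _ _)]
  congr 1
  ext x a i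
  simp [hΦ, segmentDFT_mul]

lemma exists_sampleLaw_eq_map_mixedLaw (S₀ : LDS p) (ω : ℝ) (s : Sampling) :
    ∃ (κ : Type) (_ : Fintype κ) (v : κ → Fin n → ℂ),
      ∀ (S : LDS p) (A : Matrix (Fin p) (Fin p) ℝ), S.r = S₀.r →
        (∀ ω, (1 - S.transfer ω)⁻¹ = A.map Complex.ofReal) →
        S.sampleLaw n ω s = (mixedLaw A (gaussianSum v)).map fun w a i => w i a := by
  let Φ : (Fin p → Fin n → ℂ) →L[ℝ] (Fin n → Fin p → ℂ) :=
    ContinuousLinearMap.pi fun a => ContinuousLinearMap.pi fun i =>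
      ContinuousLinearMap.proj a ∘L ContinuousLinearMap.proj i
  have hΦ : ⇑Φ = fun w a i => w i a := rfl
  have hmix {κ : Type} [Fintype κ] (A : Matrix (Fin p) (Fin p) ℝ) (v : κ → Fin n → ℂ) :
      (mixedLaw A (gaussianSum v)).map (fun w a i => w i a) =
        gaussianSum fun x : Fin p × κ => fun a i => A i x.1 • v x.2 a := by
    rw [mixedLaw_gaussianSum, ← hΦ, map_gaussianSum]
    rfl
  cases s with
  | spectral =>
    obtain ⟨c, hc⟩ : ∃ c : Unit ⊕ Unit → ℂ,
        complexGaussian (S₀.noisePsd ω).re.toNNReal = gaussianSum c :=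
      ⟨_, complexGaussian_eq_gaussianSum _⟩
    refine ⟨Fin n × _, inferInstance, fun x => Pi.single x.1 (c x.2), fun S A hr hA => ?_⟩
    rw [hmix]
    exact sampleLaw_spectral n (by rwa [noisePsd, hr]) (hA ω)
  | restartRecord N =>
    obtain ⟨B, hB⟩ := exists_eq_mul_transpose (S₀.posSemidef_toeplitz N)
    refine ⟨Fin n × Fin N, inferInstance, fun x => Pi.single x.1 (finiteDFT N ω fun t => B t x.2),
      fun S A hr hA => ?_⟩
    rw [hmix]
    exact sampleLaw_restartRecord n (hr ▸ hB) hA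
  | continuous N =>
    obtain ⟨B, hB⟩ := exists_eq_mul_transpose (S₀.posSemidef_toeplitz (n * N))
    refine ⟨_, inferInstance, fun l a => finiteDFT N ω fun t => B (finProdFinEquiv (a, t)) l,
      fun S A hr hA => ?_⟩
    rw [hmix]
    exact sampleLaw_continuous n (hr ▸ hB) hA

end SampleLaw

end LDS

section OperatorNorm

open scoped MatrixOrder Matrix.Norms.L2Operator

variable {ι : Type*} [Fintype ι] [DecidableEq ι]

lemma forall_eigenvalues_mem_iff {Φ : Matrix ι ι ℂ} (hΦ : Φ.IsHermitian) {a b : ℝ} :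
    (∀ i, a ≤ hΦ.eigenvalues i ∧ hΦ.eigenvalues i ≤ b) ↔
      algebraMap ℝ _ a ≤ Φ ∧ Φ ≤ algebraMap ℝ _ b := by
  rw [algebraMap_le_iff_le_spectrum hΦ, le_algebraMap_iff_spectrum_le hΦ,
    hΦ.spectrum_real_eq_range_eigenvalues, Set.forall_mem_range, Set.forall_mem_range, forall_and]

lemma forall_eigenvalues_mem_iff_norm_sq_le {Φ B P : Matrix ι ι ℂ} (hΦ : Φ.IsHermitian)
    {σ M : ℝ} (hσ : 0 ≤ σ) (hM : 0 < M) (hP : Φ = P * ((σ : ℂ) • 1) * P.conjTranspose)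
    (hBP : B * P = 1) :
    (∀ i, M⁻¹ ≤ hΦ.eigenvalues i ∧ hΦ.eigenvalues i ≤ M) ↔
      ‖B‖ ^ 2 ≤ M * σ ∧ σ * ‖P‖ ^ 2 ≤ M := by
  have hΦP : Φ = σ • (P * star P) := by
    rw [hP, Matrix.star_eq_conjTranspose]
    ext
    simp
  have hPB : P * B = 1 := mul_eq_one_comm.1 hBP
  have hPB' : star B * star P = 1 := by rw [← star_mul, hPB, star_one]
  have hBP' : star P * star B = 1 := by rw [← star_mul, hBP, star_one]
  have hnorm (C : Matrix ι ι ℂ) : ‖C * star C‖ = ‖C‖ ^ 2 := by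
    rw [CStarRing.norm_self_mul_star, sq]
  have hlower : algebraMap ℝ _ M⁻¹ ≤ Φ ↔ M⁻¹ • (B * star B) ≤ algebraMap ℝ _ σ := by
    constructor <;> intro h
    · have := star_right_conjugate_le_conjugate h B
      simpa [hΦP, Algebra.algebraMap_eq_smul_one, mul_assoc, hBP', ← mul_assoc B P, hBP] using this
    · have := star_right_conjugate_le_conjugate h P
      simpa [hΦP, Algebra.algebraMap_eq_smul_one, mul_assoc, hPB', ← mul_assoc P B, hPB] using this
  rw [forall_eigenvalues_mem_iff, hlower, hΦP,
    ← CStarAlgebra.norm_le_iff_le_algebraMap _ hσ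
      (smul_nonneg (inv_nonneg.2 hM.le) (mul_star_self_nonneg B)),
    ← CStarAlgebra.norm_le_iff_le_algebraMap _ hM.le (smul_nonneg hσ (mul_star_self_nonneg P)),
    norm_smul_of_nonneg hσ, norm_smul_of_nonneg (inv_nonneg.2 hM.le), hnorm, hnorm,
    inv_mul_le_iff₀ hM]

lemma sum_sq_norm_mulVec_le (B : Matrix ι ι ℂ) (u : ι → ℂ) :
    ∑ i, ‖B.mulVec u i‖ ^ 2 ≤ ‖B‖ ^ 2 * ∑ i, ‖u i‖ ^ 2 := by
  have h := pow_le_pow_left₀ (norm_nonneg _) (Matrix.l2_opNorm_mulVec B (WithLp.toLp 2 u)) 2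
  simpa [mul_pow, EuclideanSpace.norm_sq_eq] using h

lemma norm_sq_le_of_sum_sq_norm_mulVec_le {B : Matrix ι ι ℂ} {c : ℝ} (hc : 0 ≤ c)
    (h : ∀ u : ι → ℂ, ∑ i, ‖B.mulVec u i‖ ^ 2 ≤ c * ∑ i, ‖u i‖ ^ 2) : ‖B‖ ^ 2 ≤ c := by
  rw [← Real.le_sqrt (norm_nonneg _) hc, Matrix.cstar_norm_def]
  refine ContinuousLinearMap.opNorm_le_bound _ (Real.sqrt_nonneg _) fun u => ?_
  refine (sq_le_sq₀ (norm_nonneg _) (by positivity)).1 ?_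
  rw [mul_pow, Real.sq_sqrt hc, EuclideanSpace.norm_sq_eq, EuclideanSpace.norm_sq_eq]
  exact h u

lemma sum_sq_norm_row_le (B : Matrix ι ι ℂ) (i : ι) : ∑ j, ‖B i j‖ ^ 2 ≤ ‖B‖ ^ 2 := by
  have h := sum_sq_norm_mulVec_le B.conjTranspose (Pi.single i 1)
  simpa [Matrix.l2_opNorm_conjTranspose, Pi.single_apply, apply_ite] using h

lemma exists_pos_sq_eq_one_add_mul (b : ℝ) : ∃ s : ℝ, 0 < s ∧ s ^ 2 = 1 + b * s := by
  have hsq := Real.sq_sqrt (show 0 ≤ b ^ 2 + 4 by positivity)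
  have hlt : -b < √(b ^ 2 + 4) := Real.lt_sqrt_of_sq_lt (by linarith [neg_sq b])
  exact ⟨(b + √(b ^ 2 + 4)) / 2, by linarith, by linear_combination hsq / 4⟩

lemma sq_le_norm_sq_of_shear {B : Matrix ι ι ℂ} {i j : ι} (hij : i ≠ j) (hii : B i i = 1)
    (hjj : B j j = 1) (hji : B j i = 0) {b s : ℝ} (hb : 0 < b) (hbB : b ≤ ‖B i j‖) (hs : 0 < s)
    (hs2 : s ^ 2 = 1 + b * s) : s ^ 2 ≤ ‖B‖ ^ 2 := by
  have hg : 0 < ‖B i j‖ := hb.trans_le hbB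
  let θ : ℂ := B i j / ‖B i j‖
  let u : ι → ℂ := Pi.single i θ + Pi.single j (s : ℂ)
  have hθ : ‖θ‖ = 1 := by simp [θ, hg.ne']
  have hui : B.mulVec u i = θ * (1 + ‖B i j‖ * s : ℝ) := by
    have : θ * ‖B i j‖ = B i j := div_mul_cancel₀ _ (by exact_mod_cast hg.ne')
    have hval : B.mulVec u i = θ + s * B i j := by simp [u, Matrix.mulVec_add, hii]
    rw [hval]
    push_cast
    linear_combination (-(s : ℂ)) * this
  have huj : B.mulVec u j = s := by simp [u, Matrix.mulVec_add, hji, hjj]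
  have hnorm : ∑ k, ‖u k‖ ^ 2 = 1 + s ^ 2 := by
    rw [← Finset.sum_subset (Finset.subset_univ {i, j}), Finset.sum_pair hij]
    · simp [u, hij, hij.symm, hθ]
    · intro k _ hk
      simp only [Finset.mem_insert, Finset.mem_singleton, not_or] at hk
      simp [u, hk.1, hk.2]
  have hpair : s ^ 2 ≤ ‖B.mulVec u i‖ := by
    rw [hui, norm_mul, hθ, one_mul, Complex.norm_real, Real.norm_eq_abs, hs2]
    exact le_abs.2 (.inl (by gcongr))
  refine le_of_mul_le_mul_right ?_ (show 0 < 1 + s ^ 2 by positivity)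
  calc s ^ 2 * (1 + s ^ 2) = (s ^ 2) ^ 2 + s ^ 2 := by ring
    _ ≤ ‖B.mulVec u i‖ ^ 2 + ‖B.mulVec u j‖ ^ 2 := by
      rw [huj, Complex.norm_real, Real.norm_eq_abs, sq_abs]
      gcongr
    _ = ∑ k ∈ {i, j}, ‖B.mulVec u k‖ ^ 2 := by rw [Finset.sum_pair hij]
    _ ≤ ∑ k, ‖B.mulVec u k‖ ^ 2 :=
      Finset.sum_le_univ_sum_of_nonneg fun _ => sq_nonneg _
    _ ≤ ‖B‖ ^ 2 * (1 + s ^ 2) := hnorm ▸ sum_sq_norm_mulVec_le B u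

end OperatorNorm

open scoped ComplexOrder in
lemma pos_and_isUnit_of_posDef {ι : Type*} [Fintype ι] [DecidableEq ι] [Nonempty ι]
    {P : Matrix ι ι ℂ} {σ : ℝ} (h : (P * ((σ : ℂ) • 1) * P.conjTranspose).PosDef) :
    0 < σ ∧ IsUnit P := by
  constructor
  · obtain ⟨i⟩ := ‹Nonempty ι›
    have hdiag : (P * ((σ : ℂ) • 1) * P.conjTranspose) i i =
        ((σ * ∑ k, ‖P i k‖ ^ 2 : ℝ) : ℂ) := by
      simp [Matrix.mul_apply (M := P), RCLike.mul_conj]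
    have hpos := h.diag_pos (i := i)
    rw [hdiag, Complex.zero_lt_real] at hpos
    exact pos_of_mul_pos_left hpos (Finset.sum_nonneg fun _ _ => sq_nonneg _)
  · have hunit := h.isUnit
    rw [mul_assoc] at hunit
    exact isUnit_of_mul_isUnit_left hunit

lemma inv_one_sub_row_eq {ι R : Type*} [Fintype ι] [DecidableEq ι] [CommRing R]
    {H : Matrix ι ι R} (hH : IsUnit (1 - H)) {i : ι} (hi : ∀ k, (H * H) i k = 0) (k : ι) :
    (1 - H)⁻¹ i k = (1 + H) i k := by
  have hinv : (1 - H) * (1 - H)⁻¹ = 1 :=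
    Matrix.mul_nonsing_inv _ ((Matrix.isUnit_iff_isUnit_det _).1 hH)
  have : (1 - H)⁻¹ = 1 + H + H * H * (1 - H)⁻¹ := by
    calc (1 - H)⁻¹ = (1 + H) * ((1 - H) * (1 - H)⁻¹) + H * H * (1 - H)⁻¹ := by noncomm_ring
      _ = 1 + H + H * H * (1 - H)⁻¹ := by rw [hinv, mul_one]
  rw [this, Matrix.add_apply, Matrix.mul_apply, Finset.sum_eq_zero, add_zero]
  exact fun l _ => mul_eq_zero_of_left (hi l) _

section Family

open scoped ComplexOrder Matrix.Norms.L2Operator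

variable {p q : ℕ} {β M : ℝ} {σ : ℝ → ℝ} {S : LDS p}

lemma LDS.transfer_eq_zero {i j : Fin p} (h : ¬ S.graph.Adj j i) (ω : ℝ) :
    S.transfer ω i j = 0 := by
  have h0 : S.h i j = 0 := not_not.1 h
  simp [transfer, dtft, h0]

lemma LDS.not_adj_self (S : LDS p) (i : Fin p) : ¬ S.graph.Adj i i :=
  fun h => S.acyclic i (Relation.TransGen.single h)

lemma pos_and_norm_sq_le_of_mem_family [Nonempty (Fin p)] (hM : 0 < M)
    (hS : S ∈ family p q β σ M) {ω : ℝ} (hω : ω ∈ Set.Icc 0 (2 * Real.pi)) :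
    0 < σ ω ∧ IsUnit (1 - S.transfer ω) ∧
      ‖1 - S.transfer ω‖ ^ 2 ≤ M * σ ω ∧ σ ω * ‖(1 - S.transfer ω)⁻¹‖ ^ 2 ≤ M := by
  obtain ⟨-, hnoise, heig⟩ := hS.2 ω hω
  have hΦ : S.psdm ω = (1 - S.transfer ω)⁻¹ * ((σ ω : ℂ) • 1) *
      ((1 - S.transfer ω)⁻¹).conjTranspose := by rw [LDS.psdm, hnoise]
  have hpos : (S.psdm ω).PosDef :=
    (S.psdm_isHermitian ω).posDef_iff_eigenvalues_pos.2 fun i =>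
      (inv_pos.2 hM).trans_le (heig i).1
  obtain ⟨hσ, hunit⟩ := pos_and_isUnit_of_posDef (hΦ ▸ hpos)
  rw [Matrix.isUnit_nonsing_inv_iff] at hunit
  have hinv := Matrix.mul_nonsing_inv _ ((Matrix.isUnit_iff_isUnit_det _).1 hunit)
  exact ⟨hσ, hunit, (forall_eigenvalues_mem_iff_norm_sq_le _ hσ.le hM hΦ hinv).1 heig⟩

lemma IsAcyclic.exists_adj_of_parents_sources {V : Type*} [Finite V] {G : Digraph V}
    (hG : IsAcyclic G) (hne : ∃ i j, G.Adj j i) :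
    ∃ i j, G.Adj j i ∧ ∀ k, G.Adj k i → ∀ l, ¬ G.Adj l k := by
  have : Std.Irrefl (Relation.TransGen G.Adj) := ⟨hG⟩
  have hwf : WellFounded (Relation.TransGen G.Adj) := Finite.wellFounded_of_trans_of_irrefl _
  obtain ⟨i, ⟨j, hj⟩, hmin⟩ := hwf.has_min {i | ∃ j, G.Adj j i} hne
  exact ⟨i, j, hj, fun k hk l hl => hmin k ⟨l, hl⟩ (Relation.TransGen.single hk)⟩

lemma shear_bounds_of_mem_family (hβ : 0 < β) (hM : 0 < M) (hS : S ∈ family p q β σ M)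
    (hne : ∃ i j, S.graph.Adj j i) {s : ℝ} (hs : 0 < s) (hs2 : s ^ 2 = 1 + β * s) {ω : ℝ}
    (hω : ω ∈ Set.Icc 0 (2 * Real.pi)) :
    s ^ 2 ≤ M * σ ω ∧ σ ω * s ^ 2 ≤ M := by
  obtain ⟨i, j, hji, hsrc⟩ := S.acyclic.exists_adj_of_parents_sources hne
  have : Nonempty (Fin p) := ⟨i⟩
  obtain ⟨hσ, hunit, hlo, hup⟩ := pos_and_norm_sq_le_of_mem_family hM hS hω
  have hij : i ≠ j := fun h => S.not_adj_self i (h ▸ hji)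
  have hβH : β ≤ ‖S.transfer ω i j‖ := (hS.2 ω hω).1 i j hji
  have hHii : S.transfer ω i i = 0 := LDS.transfer_eq_zero (S.not_adj_self i) ω
  have hHj (k) : S.transfer ω j k = 0 := LDS.transfer_eq_zero (hsrc j hji k) ω
  have hPi (l) : (1 - S.transfer ω)⁻¹ i l = (1 + S.transfer ω) i l := by
    refine inv_one_sub_row_eq hunit (fun l => ?_) l
    rw [Matrix.mul_apply]
    refine Finset.sum_eq_zero fun k _ => ?_
    by_cases hk : S.graph.Adj k i
    · exact mul_eq_zero_of_right _ (LDS.transfer_eq_zero (hsrc k hk l) ω)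
    · exact mul_eq_zero_of_left (LDS.transfer_eq_zero hk ω) _
  have hPj (l) : (1 - S.transfer ω)⁻¹ j l = (1 + S.transfer ω) j l :=
    inv_one_sub_row_eq hunit (fun _ => by simp [Matrix.mul_apply, hHj]) l
  constructor
  · refine (sq_le_norm_sq_of_shear hij ?_ ?_ ?_ hβ ?_ hs hs2).trans hlo <;>
      simp [hHii, hHj, hij, hij.symm, hβH]
  · refine (mul_le_mul_of_nonneg_left
      (sq_le_norm_sq_of_shear hij ?_ ?_ ?_ hβ ?_ hs hs2) hσ.le).trans hup <;>
      simp [hPi, hPj, hHii, hHj, hij, hij.symm, hβH]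

lemma one_add_card_parents_mul_sq_le_of_mem_family (hβ : 0 ≤ β) (hM : 0 < M)
    (hS : S ∈ family p q β σ M) (i : Fin p) {ω : ℝ} (hω : ω ∈ Set.Icc 0 (2 * Real.pi)) :
    1 + (parents S.graph i).ncard * β ^ 2 ≤ M * σ ω := by
  classical
  have : Nonempty (Fin p) := ⟨i⟩
  obtain ⟨-, -, hlo, -⟩ := pos_and_norm_sq_le_of_mem_family hM hS hω
  let s : Finset (Fin p) := (parents S.graph i).toFinset
  have hi : i ∉ s := fun h => S.not_adj_self i (Set.mem_toFinset.1 h)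
  have hrow : ∀ j ∈ s, β ^ 2 ≤ ‖(1 - S.transfer ω) i j‖ ^ 2 := fun j hj => by
    have hij : i ≠ j := fun h => hi (h ▸ hj)
    have := (hS.2 ω hω).1 i j (Set.mem_toFinset.1 hj)
    simpa [hij] using pow_le_pow_left₀ hβ this 2
  have hdiag : ‖(1 - S.transfer ω) i i‖ ^ 2 = 1 := by
    simp [LDS.transfer_eq_zero (S.not_adj_self i)]
  calc 1 + (parents S.graph i).ncard * β ^ 2
      = ‖(1 - S.transfer ω) i i‖ ^ 2 + s.card • β ^ 2 := by
        rw [hdiag, nsmul_eq_mul, Set.ncard_eq_toFinset_card']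
    _ ≤ ‖(1 - S.transfer ω) i i‖ ^ 2 + ∑ j ∈ s, ‖(1 - S.transfer ω) i j‖ ^ 2 := by
        gcongr
        exact Finset.card_nsmul_le_sum _ _ _ hrow
    _ = ∑ j ∈ insert i s, ‖(1 - S.transfer ω) i j‖ ^ 2 := by rw [Finset.sum_insert hi]
    _ ≤ ∑ j, ‖(1 - S.transfer ω) i j‖ ^ 2 :=
        Finset.sum_le_univ_sum_of_nonneg fun _ => sq_nonneg _
    _ ≤ ‖1 - S.transfer ω‖ ^ 2 := sum_sq_norm_row_le _ i
    _ ≤ M * σ ω := hlo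

lemma card_parents_mul_sq_le_of_mem_family (hβ : 0 < β) (hM : 0 < M) (hS : S ∈ family p q β σ M)
    {i : Fin p} (hi : (parents S.graph i).Nonempty) :
    (parents S.graph i).ncard * β ^ 2 ≤ M ^ 2 - 1 := by
  have : Nonempty (Fin p) := ⟨i⟩
  have h0 : (0 : ℝ) ∈ Set.Icc 0 (2 * Real.pi) := ⟨le_rfl, Real.two_pi_pos.le⟩
  have hσ := (pos_and_norm_sq_le_of_mem_family hM hS h0).1
  obtain ⟨s, hs, hs2⟩ := exists_pos_sq_eq_one_add_mul β
  have hs1 : 1 ≤ s ^ 2 := by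
    rw [hs2]
    exact le_add_of_nonneg_right (by positivity)
  have hσM : σ 0 ≤ M :=
    (le_mul_of_one_le_right hσ.le hs1).trans
      (shear_bounds_of_mem_family hβ hM hS ⟨i, hi⟩ hs hs2 h0).2
  have hcard := one_add_card_parents_mul_sq_le_of_mem_family hβ.le hM hS i h0
  linarith [mul_le_mul_of_nonneg_left hσM hM.le]

end Family

section Matching

variable {ν R : Type*} [DecidableEq ν] {T : Finset ν}

/-- The matrix of gains of the bipartite graph that matches `i ∈ T` with `π i ∉ T` through an edge
`π i → i` of gain `b`. Indices `i ∈ T` with `π i ∈ T` are left unmatched, so that the edges always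
run from the complement of `T` to `T`. -/
def matchingMatrix [Zero R] (b : R) (T : Finset ν) (π : Equiv.Perm ν) : Matrix ν ν R :=
  Matrix.of fun i j => if π i = j ∧ i ∈ T ∧ j ∉ T then b else 0

lemma matchingMatrix_apply [Zero R] (b : R) (π : Equiv.Perm ν) (i j : ν) :
    matchingMatrix b T π i j = if π i = j ∧ i ∈ T ∧ j ∉ T then b else 0 := rfl

lemma matchingMatrix_empty [Zero R] (b : R) (π : Equiv.Perm ν) : matchingMatrix b ∅ π = 0 := by
  ext i j
  simp [matchingMatrix_apply]

lemma matchingMatrix_neg [Ring R] (b : R) (π : Equiv.Perm ν) :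
    matchingMatrix (-b) T π = -matchingMatrix b T π := by
  ext i j
  simp only [matchingMatrix_apply, Matrix.neg_apply]
  split_ifs <;> simp

variable [Fintype ν]

lemma matchingMatrix_mul_self [Ring R] (b : R) (π : Equiv.Perm ν) :
    matchingMatrix b T π * matchingMatrix b T π = 0 := by
  ext i k
  rw [Matrix.mul_apply]
  refine Finset.sum_eq_zero fun j _ => ?_
  simp only [matchingMatrix_apply]
  split_ifs <;> simp_all

lemma one_sub_mul_one_add_matchingMatrix [Ring R] (b : R) (π : Equiv.Perm ν) :
    (1 - matchingMatrix b T π) * (1 + matchingMatrix b T π) = 1 := by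
  rw [sub_mul, mul_add, mul_add, one_mul, one_mul, mul_one, matchingMatrix_mul_self]
  abel

lemma det_one_add_matchingMatrix [CommRing R] (b : R) (π : Equiv.Perm ν) :
    (1 + matchingMatrix b T π).det = 1 := by
  have hblock (P : ν → Prop) [DecidablePred P] (hP : (∀ i, P i → i ∈ T) ∨ ∀ i, P i → i ∉ T) :
      (1 + matchingMatrix b T π).toSquareBlockProp P = 1 := by
    ext i j
    have : ¬ (π i = j ∧ (i : ν) ∈ T ∧ (j : ν) ∉ T) := fun h =>
      hP.elim (fun hP => h.2.2 (hP j j.2)) fun hP => hP i i.2 h.2.1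
    simp [Matrix.toSquareBlockProp, matchingMatrix_apply, this, Matrix.one_apply, Subtype.ext_iff]
  rw [Matrix.twoBlockTriangular_det' _ (· ∉ T), hblock _ (.inr fun _ => id),
    hblock _ (.inl fun _ => not_not.1), Matrix.det_one, Matrix.det_one, one_mul]
  intro i hi j hj
  have hij : i ≠ j := fun h => hj (h ▸ hi)
  simp [matchingMatrix_apply, hi, hij]

lemma sum_sq_one_add_matchingMatrix_le (b : ℝ) (π : Equiv.Perm ν) :
    ∑ i, ∑ j, (1 + matchingMatrix b T π) i j ^ 2 ≤ Fintype.card ν + T.card * b ^ 2 := by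
  have hentry (i j : ν) : (1 + matchingMatrix b T π) i j ^ 2 ≤
      (if i = j then 1 else 0) + if π i = j then (if i ∈ T then b ^ 2 else 0) else 0 := by
    by_cases hij : i = j
    · subst hij
      have : ¬ (π i = i ∧ i ∈ T ∧ i ∉ T) := fun h => h.2.2 h.2.1
      simp only [Matrix.add_apply, Matrix.one_apply_eq, matchingMatrix_apply, if_neg this]
      split_ifs <;> simp [sq_nonneg]
    · simp only [Matrix.add_apply, Matrix.one_apply_ne hij, matchingMatrix_apply]
      split_ifs <;> simp_all [sq_nonneg]
  calc ∑ i, ∑ j, (1 + matchingMatrix b T π) i j ^ 2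
      ≤ ∑ i, ∑ j, ((if i = j then 1 else 0) +
          if π i = j then (if i ∈ T then b ^ 2 else 0) else 0) :=
        Finset.sum_le_sum fun i _ => Finset.sum_le_sum fun j _ => hentry i j
    _ = Fintype.card ν + T.card * b ^ 2 := by simp [Finset.sum_add_distrib]

lemma sq_norm_add_mul_le {b x z : ℂ} {s : ℝ} (hs : 0 < s) (hs2 : s ^ 2 = 1 + ‖b‖ * s) :
    ‖x + b * z‖ ^ 2 ≤ s ^ 2 * ‖x‖ ^ 2 + (s ^ 2 - 1) * ‖z‖ ^ 2 := by
  have htri : ‖x + b * z‖ ≤ ‖x‖ + ‖b‖ * ‖z‖ := (norm_add_le _ _).trans_eq (by rw [norm_mul])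
  have hb : ‖b‖ = s - 1 / s := by
    field_simp
    linarith
  have hsquare : s ^ 2 * ‖x‖ ^ 2 + (s ^ 2 - 1) * ‖z‖ ^ 2 - (‖x‖ + ‖b‖ * ‖z‖) ^ 2 =
      ‖b‖ / s * (s * ‖x‖ - ‖z‖) ^ 2 := by
    rw [hb]
    field_simp
    ring
  refine (pow_le_pow_left₀ (norm_nonneg _) htri 2).trans (sub_nonneg.1 ?_)
  rw [hsquare]
  positivity

open scoped Matrix.Norms.L2Operator in
lemma norm_sq_one_add_matchingMatrix_le {b : ℂ} (π : Equiv.Perm ν) {s : ℝ} (hs : 0 < s)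
    (hs2 : s ^ 2 = 1 + ‖b‖ * s) : ‖1 + matchingMatrix b T π‖ ^ 2 ≤ s ^ 2 := by
  have hs1 : 0 ≤ s ^ 2 - 1 := by
    rw [hs2, add_sub_cancel_left]
    positivity
  refine norm_sq_le_of_sum_sq_norm_mulVec_le (sq_nonneg s) fun v => ?_
  let g : ν → ℝ := fun i => if i ∈ T then 0 else (s ^ 2 - 1) * ‖v i‖ ^ 2
  have hg (i : ν) : 0 ≤ g i := by
    simp only [g]
    split_ifs <;> positivity
  have hval (i : ν) : (1 + matchingMatrix b T π).mulVec v i =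
      v i + if i ∈ T ∧ π i ∉ T then b * v (π i) else 0 := by
    rw [Matrix.add_mulVec, Matrix.one_mulVec, Pi.add_apply]
    simp [Matrix.mulVec, dotProduct, matchingMatrix_apply, ite_and]
  have hrow (i : ν) : ‖(1 + matchingMatrix b T π).mulVec v i‖ ^ 2 ≤
      s ^ 2 * ‖v i‖ ^ 2 - g i + g (π i) := by
    rw [hval]
    split_ifs with h
    · simpa [g, h.1, h.2] using sq_norm_add_mul_le hs hs2
    · have hgi : g i ≤ (s ^ 2 - 1) * ‖v i‖ ^ 2 := by
        simp only [g]
        split_ifs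
        · positivity
        · rfl
      rw [add_zero]
      linarith [hg (π i)]
  calc ∑ i, ‖(1 + matchingMatrix b T π).mulVec v i‖ ^ 2
      ≤ ∑ i, (s ^ 2 * ‖v i‖ ^ 2 - g i + g (π i)) := Finset.sum_le_sum fun i _ => hrow i
    _ = s ^ 2 * ∑ i, ‖v i‖ ^ 2 := by
      rw [Finset.sum_add_distrib, Finset.sum_sub_distrib, Equiv.sum_comp π g, sub_add_cancel,
        Finset.mul_sum]

end Matching

lemma exists_perm_forall_notMem {ν : Type*} [Fintype ν] {T : Finset ν}
    (hT : 2 * T.card ≤ Fintype.card ν) : ∃ π : Equiv.Perm ν, ∀ i ∈ T, π i ∉ T := by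
  classical
  obtain ⟨U, hUT, hU⟩ : ∃ U ⊆ Tᶜ, U.card = T.card := by
    refine Finset.exists_subset_card_eq ?_
    rw [Finset.card_compl]
    omega
  let e := Finset.equivOfCardEq hU.symm
  exact ⟨e.extendSubtype, fun i hi =>
    Finset.mem_compl.1 (hUT (e.extendSubtype_mem i hi))⟩

lemma isAcyclic_of_forall_adj {V : Type*} {G : Digraph V} (T : Set V)
    (h : ∀ i j, G.Adj i j → i ∉ T ∧ j ∈ T) : IsAcyclic G := by
  intro i hi
  obtain ⟨_, hout, -⟩ := Relation.TransGen.head'_iff.1 hi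
  obtain ⟨_, -, hin⟩ := Relation.TransGen.tail'_iff.1 hi
  exact (h _ _ hout).1 (h _ _ hin).2

lemma dtft_single (a ω : ℝ) : dtft (Pi.single 0 a) ω = a := by
  rw [dtft, tsum_eq_single 0 fun k hk => by simp [hk]]
  simp

section MatchingSystem

variable {p q : ℕ} {β M : ℝ} {σ : ℝ → ℝ} {S₀ : LDS p} {T : Finset (Fin p)}
  {π : Equiv.Perm (Fin p)}

/-- The memoryless system with gains `matchingMatrix β T π` and with the noise of `S₀`: its
equations are `x_i = β x_{π i} + e_i` at the matched nodes, and `x_i = e_i` elsewhere. -/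
def matchingSystem (S₀ : LDS p) (β : ℝ) (T : Finset (Fin p)) (π : Equiv.Perm (Fin p)) : LDS p where
  h i j := Pi.single 0 (matchingMatrix β T π i j)
  h_summable i j := (hasSum_pi_single 0 _).summable
  acyclic := isAcyclic_of_forall_adj T fun j i hji => by
    by_contra hij
    exact hji (Pi.single_eq_zero_iff.2 (if_neg fun h => hij h.2.symm))
  r := S₀.r
  r_summable := S₀.r_summable
  r_symm := S₀.r_symm
  r_posSemidef := S₀.r_posSemidef

lemma matchingSystem_adj_iff (hβ : β ≠ 0) {i j : Fin p} :
    (matchingSystem S₀ β T π).graph.Adj j i ↔ π i = j ∧ i ∈ T ∧ j ∉ T := by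
  change (Pi.single 0 (matchingMatrix β T π i j) : ℤ → ℝ) ≠ 0 ↔ _
  rw [Ne, Pi.single_eq_zero_iff, matchingMatrix_apply, ite_eq_right_iff]
  tauto

lemma transfer_matchingSystem (ω : ℝ) :
    (matchingSystem S₀ β T π).transfer ω = matchingMatrix (β : ℂ) T π := by
  ext i j
  refine (dtft_single _ _).trans ?_
  simp only [matchingMatrix_apply]
  split_ifs <;> simp

lemma inv_one_sub_transfer_matchingSystem (ω : ℝ) :
    (1 - (matchingSystem S₀ β T π).transfer ω)⁻¹ = 1 + matchingMatrix (β : ℂ) T π := by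
  rw [transfer_matchingSystem]
  exact Matrix.inv_eq_right_inv (one_sub_mul_one_add_matchingMatrix _ _)

lemma one_add_matchingMatrix_ofReal :
    1 + matchingMatrix (β : ℂ) T π = (1 + matchingMatrix β T π).map Complex.ofReal := by
  ext i j
  simp only [matchingMatrix_apply, Matrix.add_apply, Matrix.map_apply, Matrix.one_apply]
  split_ifs <;> simp

lemma matchingSystem_mem_family (hq : 1 ≤ q) (hβ : 0 < β) (hM : 0 < M)
    (hS₀ : S₀ ∈ family p q β σ M) (hne : ∃ i j, S₀.graph.Adj j i) :
    matchingSystem S₀ β T π ∈ family p q β σ M := by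
  refine ⟨⟨(matchingSystem S₀ β T π).acyclic, fun i => ?_⟩,
    fun ω hω => ⟨fun i j hji => ?_, (hS₀.2 ω hω).2.1, ?_⟩⟩
  · have hsub : parents (matchingSystem S₀ β T π).graph i ⊆ {π i} := fun j hj =>
      ((matchingSystem_adj_iff hβ.ne').1 hj).1.symm
    exact (Set.ncard_le_ncard hsub).trans (by simpa using hq)
  · rw [transfer_matchingSystem, matchingMatrix_apply,
      if_pos ((matchingSystem_adj_iff hβ.ne').1 hji), Complex.norm_real]
    exact le_abs_self β
  · have : Nonempty (Fin p) := hne.nonempty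
    obtain ⟨s, hs, hs2⟩ := exists_pos_sq_eq_one_add_mul β
    obtain ⟨hlo, hup⟩ := shear_bounds_of_mem_family hβ hM hS₀ hne hs hs2 hω
    have hσ := (pos_and_norm_sq_le_of_mem_family hM hS₀ hω).1
    have hs2' : s ^ 2 = 1 + ‖(β : ℂ)‖ * s := by
      rwa [Complex.norm_real, Real.norm_of_nonneg hβ.le]
    have hΦ : (matchingSystem S₀ β T π).psdm ω = (1 + matchingMatrix (β : ℂ) T π) *
        ((σ ω : ℂ) • 1) * (1 + matchingMatrix (β : ℂ) T π).conjTranspose := by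
      rw [LDS.psdm, inv_one_sub_transfer_matchingSystem, ← (hS₀.2 ω hω).2.1]
      rfl
    refine (forall_eigenvalues_mem_iff_norm_sq_le _ hσ.le hM hΦ
      (one_sub_mul_one_add_matchingMatrix _ _)).2 ⟨?_, ?_⟩
    · rw [sub_eq_add_neg, ← matchingMatrix_neg]
      exact (norm_sq_one_add_matchingMatrix_le π hs (by rwa [norm_neg])).trans hlo
    · exact (mul_le_mul_of_nonneg_left
        (norm_sq_one_add_matchingMatrix_le π hs hs2') hσ.le).trans hup

end MatchingSystem

lemma matchingSystem_graph_injOn {p : ℕ} {S₀ : LDS p} {β : ℝ} (hβ : β ≠ 0)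
    {π : Finset (Fin p) → Equiv.Perm (Fin p)} :
    Set.InjOn (fun T => (matchingSystem S₀ β T (π T)).graph) {T | ∀ i ∈ T, π T i ∉ T} := by
  have hmem {T : Finset (Fin p)} (hT : ∀ i ∈ T, π T i ∉ T) (i : Fin p) :
      i ∈ T ↔ ∃ j, (matchingSystem S₀ β T (π T)).graph.Adj j i := by
    simp only [matchingSystem_adj_iff hβ, exists_eq_left']
    exact ⟨fun hi => ⟨hi, hT i hi⟩, And.left⟩
  intro T hT T' hT' (h : (matchingSystem S₀ β T (π T)).graph = _)
  ext i
  rw [hmem hT, hmem hT', h]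

section Ensemble

variable {p q n m : ℕ} {β M δ : ℝ} {σ : ℝ → ℝ} {S₀ : LDS p}

lemma exists_sampleLaw_matchingSystem_eq (n : ℕ) (S₀ : LDS p) (β ω : ℝ) (s : Sampling) :
    ∃ (κ : Type) (_ : Fintype κ) (v : κ → Fin n → ℂ), ∀ T π,
      (matchingSystem S₀ β T π).sampleLaw n ω s =
        (mixedLaw (1 + matchingMatrix β T π) (gaussianSum v)).map fun w a i => w i a := by
  obtain ⟨κ, hκ, v, hv⟩ := LDS.exists_sampleLaw_eq_map_mixedLaw n S₀ ω s
  refine ⟨κ, hκ, v, fun T π => hv _ _ rfl fun ω => ?_⟩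
  rw [inv_one_sub_transfer_matchingSystem, one_add_matchingMatrix_ofReal]

instance isProbabilityMeasure_sampleLaw_matchingSystem {T : Finset (Fin p)}
    {π : Equiv.Perm (Fin p)} {ω : ℝ} {s : Sampling} :
    IsProbabilityMeasure ((matchingSystem S₀ β T π).sampleLaw n ω s) := by
  obtain ⟨_, _, v, hv⟩ := exists_sampleLaw_matchingSystem_eq n S₀ β ω s
  rw [hv]
  exact Measure.isProbabilityMeasure_map (Measurable.aemeasurable (by fun_prop))

lemma klDiv_sampleLaw_matchingSystem_le (n : ℕ) (S₀ : LDS p) (β : ℝ) (T : Finset (Fin p))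
    (π π₀ : Equiv.Perm (Fin p)) (ω : ℝ) (s : Sampling) :
    klDiv ((matchingSystem S₀ β T π).sampleLaw n ω s)
        ((matchingSystem S₀ β ∅ π₀).sampleLaw n ω s) ≤
      ENNReal.ofReal (n * (T.card * β ^ 2)) := by
  obtain ⟨_, _, v, hv⟩ := exists_sampleLaw_matchingSystem_eq n S₀ β ω s
  rw [hv, hv, matchingMatrix_empty, add_zero]
  refine (klDiv_map_le _ _ (by fun_prop)).trans
    ((klDiv_mixedLaw_gaussianSum_le (by simp [det_one_add_matchingMatrix]) v).trans
      (ENNReal.ofReal_le_ofReal ?_))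
  have hrank : (Module.finrank ℝ (Fin n → ℂ) : ℝ) = n * 2 := by
    simp [Module.finrank_pi_fintype]
  have hsum := sum_sq_one_add_matchingMatrix_le (T := T) β π
  rw [hrank, mul_assoc, mul_div_assoc, mul_div_cancel_left₀ _ two_ne_zero]
  gcongr
  linarith

lemma exists_error_ge_of_matchings (hq : 1 ≤ q) (hm : 1 ≤ m) (hmp : 2 * m ≤ p) (hβ : 0 < β)
    (hM : 0 < M) (hS₀ : S₀ ∈ family p q β σ M) (hne : ∃ i j, S₀.graph.Adj j i)
    (hn : n * (m * β ^ 2) ≤ (1 - 2 * δ) * Real.log (p.choose m)) (ω : ℝ) (s : Sampling)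
    {Ghat : (Fin n → Fin p → ℂ) → Digraph (Fin p)} (hGhat : IsEstimator Ghat) :
    ∃ S ∈ family p q β σ M, δ ≤ (S.sampleLaw n ω s).real {y | S.graph ≠ Ghat y} := by
  let 𝒯 : Finset (Finset (Fin p)) := Finset.powersetCard m Finset.univ
  have hcard {T : Finset (Fin p)} (hT : T ∈ 𝒯) : T.card = m := (Finset.mem_powersetCard.1 hT).2
  have hmatch (T : Finset (Fin p)) (hT : 2 * T.card ≤ p) :
      ∃ π : Equiv.Perm (Fin p), ∀ i ∈ T, π i ∉ T :=
    exists_perm_forall_notMem (by rwa [Fintype.card_fin])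
  choose! π hπ using hmatch
  have hgraph := matchingSystem_graph_injOn (S₀ := S₀) hβ.ne' (π := π)
  have hπ' {T : Finset (Fin p)} (hT : T ∈ 𝒯) : ∀ i ∈ T, π T i ∉ T := hπ T (by rwa [hcard hT])
  have hchoose : 2 ≤ 𝒯.card := by
    rw [Finset.card_powersetCard, Finset.card_univ, Fintype.card_fin]
    have h1 := Nat.choose_pos (show m ≤ p by omega)
    have h2 : p.choose m ≠ 1 := fun h => by
      rw [Nat.choose_eq_one_iff] at h
      omega
    omega
  have hnull : ∀ T ∈ 𝒯, (matchingSystem S₀ β T (π T)).graph ≠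
      (matchingSystem S₀ β ∅ (π ∅)).graph := fun T hT h => by
    have := hgraph (hπ' hT) (by simp) h
    rw [← hcard hT, this] at hm
    simp at hm
  have hD : 0 ≤ n * (m * β ^ 2) := by positivity
  obtain h | ⟨T, -, h⟩ := exists_error_ge_of_klDiv_le hchoose
    (hgraph.mono fun T hT => hπ' hT) hnull hD
    (fun T hT => hcard hT ▸ klDiv_sampleLaw_matchingSystem_le n S₀ β T (π T) (π ∅) ω s)
    (by rwa [Finset.card_powersetCard, Finset.card_univ, Fintype.card_fin]) hGhat
  · exact ⟨_, matchingSystem_mem_family hq hβ hM hS₀ hne, h⟩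
  · exact ⟨_, matchingSystem_mem_family hq hβ hM hS₀ hne, h⟩

end Ensemble

lemma div_pow_le_choose {p q : ℕ} (hqp : q ≤ p) : ((p : ℝ) / q) ^ q ≤ p.choose q := by
  induction q generalizing p with
  | zero => simp
  | succ q ih =>
    obtain ⟨p, rfl⟩ : ∃ p', p = p' + 1 := ⟨p - 1, by omega⟩
    have hqp' : q ≤ p := by omega
    have hstep : (((p + 1 : ℕ) : ℝ) / (q + 1 : ℕ)) ^ q ≤ ((p : ℝ) / q) ^ q := by
      obtain rfl | hq := q.eq_zero_or_pos
      · simp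
      have : (q : ℝ) ≤ p := by exact_mod_cast hqp'
      refine pow_le_pow_left₀ (by positivity) ?_ q
      rw [div_le_div_iff₀ (by positivity) (by positivity)]
      push_cast
      linarith
    have hchoose : ((p + 1).choose (q + 1) : ℝ) =
        ((p + 1 : ℕ) : ℝ) / (q + 1 : ℕ) * p.choose q := by
      rw [div_mul_eq_mul_div, eq_div_iff (by positivity)]
      exact_mod_cast (Nat.add_one_mul_choose_eq p q).symm
    rw [pow_succ', hchoose]
    gcongr
    exact hstep.trans (ih hqp')

lemma mul_le_mul_of_le_mul_div {x t l l' a c : ℝ} (hx : 0 ≤ x) (hc : 0 < c) (hac : a ≤ c)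
    (hl : 0 < l) (hll' : l ≤ l') (h : x ≤ t * (l / c)) : x * a ≤ t * l' := by
  have ht : 0 ≤ t := nonneg_of_mul_nonneg_left (hx.trans h) (div_pos hl hc)
  calc x * a ≤ x * c := by gcongr
    _ ≤ t * (l / c) * c := by gcongr
    _ = t * l := by rw [mul_assoc, div_mul_cancel₀ _ hc.ne']
    _ ≤ t * l' := by gcongr

lemma exists_error_ge_of_le_log_div {p q n : ℕ} {β M δ : ℝ} {σ : ℝ → ℝ} (hq : 1 ≤ q)
    (hp : 2 ≤ p) (hβ : 0 < β) (hM : 0 < M) {S₀ : LDS p} (hS₀ : S₀ ∈ family p q β σ M)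
    (hne : ∃ i j, S₀.graph.Adj j i)
    (hn : n ≤ (1 - 2 * δ) * (Real.log p / (2 * β ^ 2 + β ^ 4))) (ω : ℝ) (s : Sampling)
    {Ghat : (Fin n → Fin p → ℂ) → Digraph (Fin p)} (hGhat : IsEstimator Ghat) :
    ∃ S ∈ family p q β σ M, δ ≤ (S.sampleLaw n ω s).real {y | S.graph ≠ Ghat y} := by
  refine exists_error_ge_of_matchings hq le_rfl hp hβ hM hS₀ hne ?_ ω s hGhat
  have hlog : 0 < Real.log p := Real.log_pos (by exact_mod_cast hp)
  have hgain : (1 : ℕ) * β ^ 2 ≤ 2 * β ^ 2 + β ^ 4 := by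
    have : 0 ≤ β ^ 2 + β ^ 4 := by positivity
    push_cast
    linarith
  exact mul_le_mul_of_le_mul_div n.cast_nonneg (by positivity) hgain hlog
    (by rw [Nat.choose_one_right]) hn

lemma exists_error_ge_of_le_mul_log_div {p q n : ℕ} {β M δ : ℝ} {σ : ℝ → ℝ} (hq : 1 ≤ q)
    (hpq : 2 * q ≤ p) (hβ : 0 < β) (hM : 0 < M) {S₀ : LDS p} (hS₀ : S₀ ∈ family p q β σ M)
    {i : Fin p} (hi : (parents S₀.graph i).ncard = q)
    (hn : n ≤ (1 - 2 * δ) * (q * Real.log (p / q) / (M ^ 2 - 1))) (ω : ℝ) (s : Sampling)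
    {Ghat : (Fin n → Fin p → ℂ) → Digraph (Fin p)} (hGhat : IsEstimator Ghat) :
    ∃ S ∈ family p q β σ M, δ ≤ (S.sampleLaw n ω s).real {y | S.graph ≠ Ghat y} := by
  have hne : (parents S₀.graph i).Nonempty := Set.nonempty_of_ncard_ne_zero (by omega)
  refine exists_error_ge_of_matchings hq hq hpq hβ hM hS₀ ⟨i, hne⟩ ?_ ω s hGhat
  have hq0 : (0 : ℝ) < q := by exact_mod_cast hq
  have hratio : 1 < (p : ℝ) / q := by
    rw [one_lt_div hq0]
    exact_mod_cast (by omega : q < p)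
  have hgain : q * β ^ 2 ≤ M ^ 2 - 1 := hi ▸ card_parents_mul_sq_le_of_mem_family hβ hM hS₀ hne
  have hchoose : q * Real.log (p / q) ≤ Real.log (p.choose q) := by
    rw [← Real.log_pow]
    exact Real.log_le_log (by positivity) (div_pow_le_choose (by omega))
  exact mul_le_mul_of_le_mul_div n.cast_nonneg (hgain.trans_lt' (by positivity)) hgain
    (mul_pos hq0 (Real.log_pos hratio)) hchoose hn

end DDAG

end

theorem theorem5p1 (p q n : ℕ) (β M δ : ℝ) (σ : ℝ → ℝ)
    (hq : 1 ≤ q) (hpq : (q : ℝ) ≤ (p : ℝ) / 2) (hβ : 0 < β) (hM : 1 < M)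
    -- the parameter `q` is attained: some system of the family has a node with `q` parents
    (hattained : ∃ S ∈ DDAG.family p q β σ M, ∃ i, (DDAG.parents S.graph i).ncard = q)
    (hn : (n : ℝ) ≤ (1 - 2 * δ) *
      max (Real.log p / (2 * β ^ 2 + β ^ 4)) (q * Real.log (p / q) / (M ^ 2 - 1)))
    (ω : ℝ) (hω : ω ∈ Set.Icc 0 (2 * Real.pi)) (s : DDAG.Sampling)
    (Ghat : (Fin n → Fin p → ℂ) → Digraph (Fin p)) (hGhat : DDAG.IsEstimator Ghat) :
    ∃ S ∈ DDAG.family p q β σ M,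
      δ ≤ (S.sampleLaw n ω s).real {y | S.graph ≠ Ghat y} := by
  obtain ⟨S₀, hS₀, i, hi⟩ := hattained
  have hM0 : 0 < M := one_pos.trans hM
  have hpq' : 2 * q ≤ p := by
    rw [le_div_iff₀' two_pos] at hpq
    exact_mod_cast hpq
  obtain h | h := max_choice (Real.log p / (2 * β ^ 2 + β ^ 4))
    (q * Real.log (p / q) / (M ^ 2 - 1)) <;> rw [h] at hn
  · have hne : (DDAG.parents S₀.graph i).Nonempty := Set.nonempty_of_ncard_ne_zero (by omega)
    exact DDAG.exists_error_ge_of_le_log_div hq (by omega) hβ hM0 hS₀ ⟨i, hne⟩ hn ω s hGhat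
  · exact DDAG.exists_error_ge_of_le_mul_log_div hq hpq' hβ hM0 hS₀ hi hn ω s hGhat
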